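/- Let $d\ge 2$ be fixed. A $d$-norm is a norm on $\mathbb{R}^d$; the set of all $d$-norms is metrized by letting the distance of two norms be the Hausdorff distance (with respect to the Euclidean metric) of their closed unit balls. For a $d$-norm $\|\cdot\|$ let $D_{\|\cdot\|}(n)$ be the minimum, over all sets $P\subset\mathbb{R}^d$ of $n$ distinct points, of the number of distinct values $\|x-y\|$ with $x,y\in P$, $x\ne y$. There are a function $\varepsilon:\mathbb{N}\to\mathbb{R}$, depending only on $d$, with $\varepsilon(n)\to 0$ as $n\to\infty$, and a meagre set $S$ of $d$-norms, such that for every $d$-norm $\|\cdot\|\notin S$ the following holds: for every $n$, any $n$ distinct points in $\mathbb{R}^d$ determine at least $(1-\varepsilon(n))\,n$ distinct distances according to $\|\cdot\|$, and $D_{\|\cdot\|}(n)=(1-o(1))\,n$ as $n\to\infty$. In particular, for every $d\ge 2$ there is a $d$-norm for which $D_{\|\cdot\|}(n)=o(n)$ fails, contrary to a conjecture of Brass. -/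

import Mathlib

open Filter Topology Asymptotics

/-- Euclidean `d`-space. Its Euclidean metric is used only to define the Hausdorff distance
between unit balls. -/
abbrev Pt (d : ℕ) : Type := EuclideanSpace ℝ (Fin d)

/-- A `d`-norm: an arbitrary norm on `ℝ^d`, i.e. a seminorm that vanishes only at `0`. -/
structure DNorm (d : ℕ) extends Seminorm ℝ (Pt d) where
  eq_zero_of_map_eq_zero' : ∀ x : Pt d, toFun x = 0 → x = 0

namespace DNorm

/-- The value `‖x‖` of the `d`-norm `N` at `x`. -/
def val {d : ℕ} (N : DNorm d) (x : Pt d) : ℝ := N.toSeminorm x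

/-- The unit ball `{x : ‖x‖ ≤ 1}` of a `d`-norm. -/
def unitBall {d : ℕ} (N : DNorm d) : Set (Pt d) := {x | N.val x ≤ 1}

theorem unitBall_nonempty {d : ℕ} (N : DNorm d) : N.unitBall.Nonempty :=
  ⟨0, by simp [unitBall, val]⟩

theorem continuous_val {d : ℕ} (N : DNorm d) : Continuous N.val := by
  have h : ConvexOn ℝ Set.univ N.val := N.toSeminorm.convexOn
  exact continuousOn_univ.1 (h.continuousOn isOpen_univ)

theorem isClosed_unitBall {d : ℕ} (N : DNorm d) : IsClosed N.unitBall :=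
  isClosed_le N.continuous_val continuous_const

theorem isBounded_unitBall {d : ℕ} (N : DNorm d) : Bornology.IsBounded N.unitBall := by
  rcases (Metric.sphere (0 : Pt d) 1).eq_empty_or_nonempty with he | hne
  · refine (Bornology.isBounded_singleton (x := (0 : Pt d))).subset fun x _ => ?_
    by_contra hx
    have hx0 : ‖x‖ ≠ 0 := norm_ne_zero_iff.2 hx
    have : (‖x‖⁻¹ • x) ∈ Metric.sphere (0 : Pt d) 1 := by
      simp [norm_smul, hx0]
    simp [he] at this
  · obtain ⟨z, hz, hmin⟩ := (isCompact_sphere (0 : Pt d) 1).exists_isMinOn hne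
      N.continuous_val.continuousOn
    have hz0 : z ≠ 0 := by
      rintro rfl
      simp at hz
    have hpos : 0 < N.val z :=
      lt_of_le_of_ne (apply_nonneg N.toSeminorm z)
        fun h => hz0 (N.eq_zero_of_map_eq_zero' z h.symm)
    refine (Metric.isBounded_closedBall (x := (0 : Pt d)) (r := (N.val z)⁻¹)).subset fun x hx => ?_
    rw [mem_closedBall_zero_iff]
    by_cases hx0 : x = 0
    · simp [hx0, hpos.le]
    have hxn : 0 < ‖x‖ := norm_pos_iff.2 hx0
    have hm : (‖x‖⁻¹ • x) ∈ Metric.sphere (0 : Pt d) 1 := by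
      simp [norm_smul, hxn.ne']
    have h1 : N.val z ≤ N.val (‖x‖⁻¹ • x) := hmin hm
    have h2 : N.val (‖x‖⁻¹ • x) = ‖x‖⁻¹ * N.val x := by
      simp [val, map_smul_eq_mul]
    have h3 : N.val x ≤ 1 := hx
    have h4 : N.val z ≤ ‖x‖⁻¹ := by
      rw [h2] at h1
      exact h1.trans (mul_le_of_le_one_right (inv_nonneg.2 hxn.le) h3)
    exact (le_inv_comm₀ hpos hxn).1 h4

theorem hausdorffEDist_ne_top {d : ℕ} (N M : DNorm d) :
    Metric.hausdorffEDist N.unitBall M.unitBall ≠ ⊤ :=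
  Metric.hausdorffEDist_ne_top_of_nonempty_of_bounded N.unitBall_nonempty M.unitBall_nonempty
    N.isBounded_unitBall M.isBounded_unitBall

theorem eq_of_unitBall_eq {d : ℕ} {N M : DNorm d} (h : N.unitBall = M.unitBall) : N = M := by
  have key : ∀ A B : DNorm d, A.unitBall = B.unitBall → ∀ x, B.val x ≤ A.val x := by
    intro A B hAB x
    by_cases hx : x = 0
    · simp [hx, val]
    have hpos : 0 < A.val x :=
      lt_of_le_of_ne (apply_nonneg A.toSeminorm x)
        fun h => hx (A.eq_zero_of_map_eq_zero' x h.symm)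
    have hs : ∀ C : DNorm d, C.val ((A.val x)⁻¹ • x) = (A.val x)⁻¹ * C.val x := by
      intro C
      simp [val, map_smul_eq_mul, abs_of_nonneg]
    have hm : (A.val x)⁻¹ • x ∈ A.unitBall := by
      change A.val _ ≤ 1
      rw [hs, inv_mul_cancel₀ hpos.ne']
    rw [hAB] at hm
    change B.val _ ≤ 1 at hm
    rw [hs, inv_mul_le_iff₀ hpos, mul_one] at hm
    exact hm
  have hS : N.toSeminorm = M.toSeminorm :=
    Seminorm.ext fun x => le_antisymm (key M N h.symm x) (key N M h x)
  cases N
  cases M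
  cases hS
  rfl

/-- The space of all `d`-norms, metrized by the Hausdorff distance (with respect to the Euclidean
metric) of their unit balls. -/
noncomputable instance instMetricSpace {d : ℕ} : MetricSpace (DNorm d) where
  dist N M := Metric.hausdorffDist N.unitBall M.unitBall
  dist_self _ := Metric.hausdorffDist_self_zero
  dist_comm _ _ := Metric.hausdorffDist_comm
  dist_triangle N M _ := Metric.hausdorffDist_triangle (hausdorffEDist_ne_top N M)
  eq_of_dist_eq_zero {N M} h := eq_of_unitBall_eq <|
    (N.isClosed_unitBall.hausdorffDist_zero_iff_eq M.isClosed_unitBall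
      (hausdorffEDist_ne_top N M)).1 h

/-- The number of distinct distances, according to `N`, between two different points of the
finite set `P`. -/
noncomputable def numDistances {d : ℕ} (N : DNorm d) (P : Finset (Pt d)) : ℕ :=
  Set.ncard {r : ℝ | ∃ x ∈ P, ∃ y ∈ P, x ≠ y ∧ N.val (x - y) = r}

/-- `D(n)`: the minimum number of distinct distances, according to `N`, determined by a set of
`n` points of `ℝ^d`. -/
noncomputable def minDistances {d : ℕ} (N : DNorm d) (n : ℕ) : ℕ :=
  sInf {k : ℕ | ∃ P : Finset (Pt d), P.card = n ∧ N.numDistances P = k}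

end DNorm

/-!
Let `P` be a finite set of points with `m` distances, `F` the field generated over `ℚ` by these
distances, and `k` the dimension of the `F`-span of the differences of points of `P`. The normalized
differences are unit vectors in this `F`-span. After clearing denominators, the unit vectors in an
`F`-space of dimension `k` are given by polynomials in `d k + m` real parameters: the coordinates of
a basis and the `m` distances. Hence a generic norm has at most `d k + m` of them up to sign:
otherwise approximate it by a polyhedral norm with facets so small that unit vectors which are not
close to each other up to sign lie on different facets; a slight shift of the facets makes the
vector of their heights avoid the smooth images of smaller dimension.

Conversely, by Ungar's theorem `P` is collinear or determines at least `|P| - 1` directions, and an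
affine basis of `P` over `F` has `k (k + 1)` different normalized differences. The latter gives
`k = O(√n)` when `m ≤ n = |P|`, and the former `m ≥ |P| - 1 - d k = (1 - o(1)) n`.
-/

/-! ### Comparison of norms -/

namespace DNorm

section Basic

variable {d : ℕ} (N M : DNorm d)

theorem val_nonneg (x : Pt d) : 0 ≤ N.val x := apply_nonneg N.toSeminorm x

theorem val_zero : N.val 0 = 0 := map_zero N.toSeminorm

theorem val_smul (a : ℝ) (x : Pt d) : N.val (a • x) = |a| * N.val x :=
  map_smul_eq_mul N.toSeminorm a x

theorem val_smul_of_nonneg {a : ℝ} (ha : 0 ≤ a) (x : Pt d) : N.val (a • x) = a * N.val x := by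
  rw [val_smul, abs_of_nonneg ha]

theorem val_add_le (x y : Pt d) : N.val (x + y) ≤ N.val x + N.val y :=
  map_add_le_add N.toSeminorm x y

theorem val_neg (x : Pt d) : N.val (-x) = N.val x := map_neg_eq_map N.toSeminorm x

theorem val_sub_le (x y : Pt d) : N.val x - N.val y ≤ N.val (x - y) :=
  (le_abs_self _).trans (abs_sub_map_le_sub N.toSeminorm x y)

theorem val_pos {x : Pt d} (hx : x ≠ 0) : 0 < N.val x :=
  (N.val_nonneg x).lt_of_ne' fun h => hx (N.eq_zero_of_map_eq_zero' x h)

theorem val_inv_smul_self {x : Pt d} (hx : x ≠ 0) : N.val ((N.val x)⁻¹ • x) = 1 := by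
  rw [val_smul_of_nonneg _ (inv_nonneg.2 (N.val_nonneg x)), inv_mul_cancel₀ (N.val_pos hx).ne']

theorem val_le_mul_of_unitBall {c : ℝ} (h : ∀ x ∈ N.unitBall, M.val x ≤ c) (x : Pt d) :
    M.val x ≤ c * N.val x := by
  by_cases hx : x = 0
  · simp only [hx, val_zero, mul_zero, le_refl]
  have h₁ := h _ (N.val_inv_smul_self hx).le
  rwa [val_smul_of_nonneg _ (inv_nonneg.2 (N.val_nonneg x)), inv_mul_le_iff₀ (N.val_pos hx),
    mul_comm] at h₁

theorem isCompact_unitBall : IsCompact N.unitBall :=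
  Metric.isCompact_of_isClosed_isBounded N.isClosed_unitBall N.isBounded_unitBall

theorem exists_val_le : ∃ C > 0, ∀ x, N.val x ≤ C * M.val x := by
  obtain ⟨z, -, hz⟩ := M.isCompact_unitBall.exists_isMaxOn M.unitBall_nonempty
    N.continuous_val.continuousOn
  exact ⟨max (N.val z) 1, by positivity, M.val_le_mul_of_unitBall N fun y hy =>
    (hz hy).trans (le_max_left _ _)⟩

variable (d) in
/-- The Euclidean norm, as a `d`-norm. -/
noncomputable def euclidean : DNorm d where
  toSeminorm := normSeminorm ℝ (Pt d)
  eq_zero_of_map_eq_zero' _ hx := norm_eq_zero.1 hx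

theorem euclidean_val (x : Pt d) : (euclidean d).val x = ‖x‖ := rfl

instance instNonempty : Nonempty (DNorm d) := ⟨euclidean d⟩

end Basic

section Topology

variable {d : ℕ} {N M : DNorm d} {c : ℝ}

/-- Two `d`-norms are within the factor `c` of each other if each is at most `c` times the other.
This multiplicative closeness defines the same topology as the Hausdorff distance of the unit
balls, see `nhds_basis_withinFactor`. -/
def WithinFactor (c : ℝ) (N M : DNorm d) : Prop :=
  (∀ x, M.val x ≤ c * N.val x) ∧ ∀ x, N.val x ≤ c * M.val x

theorem WithinFactor.mono (h : WithinFactor c N M) {c' : ℝ} (hc : c ≤ c') : WithinFactor c' N M :=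
  ⟨fun x => (h.1 x).trans (mul_le_mul_of_nonneg_right hc (N.val_nonneg x)),
    fun x => (h.2 x).trans (mul_le_mul_of_nonneg_right hc (M.val_nonneg x))⟩

theorem val_inv_smul_le_one (hc : 0 < c) (h : ∀ x, M.val x ≤ c * N.val x) {x : Pt d}
    (hx : x ∈ N.unitBall) : M.val (c⁻¹ • x) ≤ 1 := by
  rw [val_smul_of_nonneg _ (inv_nonneg.2 hc.le), inv_mul_le_iff₀ hc]
  exact (h x).trans (mul_le_mul_of_nonneg_left hx hc.le)

theorem WithinFactor.dist_le (h : WithinFactor c N M) (hc : 1 ≤ c) {R : ℝ} (hR₀ : 0 ≤ R)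
    (hR : ∀ x, ‖x‖ ≤ R * N.val x) : dist N M ≤ (c - 1) * R := by
  have hc₀ : 0 < c := one_pos.trans_le hc
  have hc₁ : 0 ≤ c - 1 := sub_nonneg.2 hc
  have hdist : ∀ x, N.val (c⁻¹ • x) ≤ 1 → dist x (c⁻¹ • x) ≤ (c - 1) * R := fun x hx =>
    calc dist x (c⁻¹ • x) = ‖(c - 1) • c⁻¹ • x‖ := by
          rw [dist_eq_norm, sub_smul, smul_inv_smul₀ hc₀.ne', one_smul]
      _ = (c - 1) * ‖c⁻¹ • x‖ := norm_smul_of_nonneg hc₁ _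
      _ ≤ (c - 1) * (R * N.val (c⁻¹ • x)) := mul_le_mul_of_nonneg_left (hR _) hc₁
      _ ≤ (c - 1) * R := mul_le_mul_of_nonneg_left (mul_le_of_le_one_right hR₀ hx) hc₁
  refine Metric.hausdorffDist_le_of_mem_dist (mul_nonneg hc₁ hR₀) (fun x hx => ?_) fun x hx => ?_
  · exact ⟨c⁻¹ • x, val_inv_smul_le_one hc₀ h.1 hx, hdist x <|
      val_inv_smul_le_one hc₀ (fun y => le_mul_of_one_le_left (N.val_nonneg y) hc) hx⟩
  · have hx' := val_inv_smul_le_one hc₀ h.2 hx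
    exact ⟨c⁻¹ • x, hx', hdist x hx'⟩

theorem exists_pos_forall_dist_lt_withinFactor (N : DNorm d) (hc : 1 < c) :
    ∃ δ > 0, ∀ M, dist M N < δ → WithinFactor c N M := by
  obtain ⟨C, hC, hNC⟩ := N.exists_val_le (euclidean d)
  simp only [euclidean_val] at hNC
  have hc₀ : 0 < c := one_pos.trans hc
  have hη : 0 < 1 - c⁻¹ := sub_pos.2 (inv_lt_one_of_one_lt₀ hc)
  have hηc : 1 - c⁻¹ ≤ c - 1 :=
    calc 1 - c⁻¹ = (c - 1) / c := by rw [sub_div, div_self hc₀.ne', one_div]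
      _ ≤ c - 1 := div_le_self (sub_pos.2 hc).le hc.le
  refine ⟨(1 - c⁻¹) / C, div_pos hη hC, fun M hM => ?_⟩
  have hclose : ∀ x y, dist x y < (1 - c⁻¹) / C → N.val (x - y) ≤ 1 - c⁻¹ := fun x y hxy => by
    rw [dist_eq_norm, lt_div_iff₀' hC] at hxy
    exact (hNC _).trans hxy.le
  constructor
  · obtain ⟨z, hzN, hz⟩ := N.isCompact_unitBall.exists_isMaxOn N.unitBall_nonempty
      M.continuous_val.continuousOn
    have hmax : ∀ x, M.val x ≤ M.val z * N.val x := N.val_le_mul_of_unitBall M fun x hx => hz hx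
    obtain ⟨y, hy : M.val y ≤ 1, hyz⟩ := Metric.exists_dist_lt_of_hausdorffDist_lt' hzN hM
      (hausdorffEDist_ne_top M N)
    have hMz : M.val z ≤ 1 + M.val z * (1 - c⁻¹) := by
      have hzy := hclose z y (by rwa [dist_comm])
      linarith [M.val_sub_le z y, hmax (z - y),
        mul_le_mul_of_nonneg_left hzy (M.val_nonneg z)]
    have hMzc : M.val z ≤ c := by
      rw [← mul_one c, ← mul_inv_le_iff₀' hc₀]
      linarith
    exact fun x => (hmax x).trans (mul_le_mul_of_nonneg_right hMzc (N.val_nonneg x))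
  · refine M.val_le_mul_of_unitBall N fun x hx => ?_
    obtain ⟨y, hy : N.val y ≤ 1, hxy⟩ := Metric.exists_dist_lt_of_hausdorffDist_lt hx hM
      (hausdorffEDist_ne_top M N)
    linarith [N.val_sub_le x y, hclose x y hxy]

theorem nhds_basis_withinFactor (N : DNorm d) :
    (𝓝 N).HasBasis (fun c : ℝ => 1 < c) fun c => {M | WithinFactor c N M} := by
  refine Metric.nhds_basis_ball.to_hasBasis (fun ε hε => ?_) fun c hc =>
    N.exists_pos_forall_dist_lt_withinFactor hc
  obtain ⟨R, hR₀, hR⟩ := (euclidean d).exists_val_le N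
  have hε' : 0 < ε / (2 * R) := by positivity
  refine ⟨1 + ε / (2 * R), by linarith, fun M hM => ?_⟩
  rw [Metric.mem_ball']
  calc dist N M ≤ (1 + ε / (2 * R) - 1) * R := hM.dist_le (by linarith) hR₀.le hR
    _ = ε / 2 := by field_simp; ring
    _ < ε := half_lt_self hε

theorem continuous_val_uncurry : Continuous fun p : DNorm d × Pt d => p.1.val p.2 := by
  have hfactor : ∀ u v : ℝ, u < v → ∃ c, 1 < c ∧ c * u < v := fun u v huv => by
    have hmul : Tendsto (· * u) (𝓝[>] 1) (𝓝 u) :=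
      ((continuous_mul_const u).tendsto' 1 u (one_mul u)).mono_left nhdsWithin_le_nhds
    exact (eventually_mem_nhdsWithin.and (hmul.eventually_lt_const huv)).exists
  refine continuous_iff_continuousAt.2 fun ⟨N, x⟩ =>
    tendsto_order.2 ⟨fun a ha => ?_, fun b hb => ?_⟩
  · obtain ⟨c, hc, hca⟩ := hfactor a (N.val x) ha
    filter_upwards [prod_mem_nhds (N.nhds_basis_withinFactor.mem_of_mem hc)
      (N.continuous_val.continuousAt.eventually_const_lt hca)] with p hp
    exact lt_of_mul_lt_mul_left (hp.2.trans_le (hp.1.2 p.2)) (zero_le_one.trans hc.le)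
  · obtain ⟨c, hc, hcb⟩ := hfactor (N.val x) b hb
    have hy : ∀ᶠ y in 𝓝 x, c * N.val y < b :=
      (continuous_const.mul N.continuous_val).continuousAt.eventually_lt_const hcb
    filter_upwards [prod_mem_nhds (N.nhds_basis_withinFactor.mem_of_mem hc) hy] with p hp
    exact (hp.1.1 p.2).trans_lt hp.2

/-- The logarithm of a `d`-norm on the Euclidean unit sphere. -/
noncomputable def logOnSphere (N : DNorm d) : C(Metric.sphere (0 : Pt d) 1, ℝ) where
  toFun x := Real.log (N.val x)
  continuous_toFun := (N.continuous_val.comp continuous_subtype_val).log fun x =>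
    (N.val_pos (ne_zero_of_mem_unit_sphere x)).ne'

open Classical in
/-- The positively homogeneous extension to `ℝ^d` of the exponential of a function on the unit
sphere. It inverts `logOnSphere`. -/
noncomputable def expExtension (f : C(Metric.sphere (0 : Pt d) 1, ℝ)) (x : Pt d) : ℝ :=
  if h : x = 0 then 0 else ‖x‖ * Real.exp (f ⟨‖x‖⁻¹ • x, by simp [norm_smul, h]⟩)

theorem expExtension_pos (f : C(Metric.sphere (0 : Pt d) 1, ℝ)) {x : Pt d} (hx : x ≠ 0) :
    0 < expExtension f x := by
  have := norm_pos_iff.2 hx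
  rw [expExtension, dif_neg hx]
  positivity

theorem expExtension_coe_sphere (f : C(Metric.sphere (0 : Pt d) 1, ℝ))
    (x : Metric.sphere (0 : Pt d) 1) : expExtension f x = Real.exp (f x) := by
  simp [expExtension, ne_zero_of_mem_unit_sphere x]

theorem expExtension_logOnSphere (N : DNorm d) (x : Pt d) :
    expExtension N.logOnSphere x = N.val x := by
  by_cases hx : x = 0
  · rw [expExtension, dif_pos hx, hx, val_zero]
  have hx' : ‖x‖⁻¹ • x ≠ 0 := smul_ne_zero (inv_ne_zero (norm_ne_zero_iff.2 hx)) hx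
  calc expExtension N.logOnSphere x = ‖x‖ * Real.exp (Real.log (N.val (‖x‖⁻¹ • x))) :=
        dif_neg hx
    _ = N.val x := by
        rw [Real.exp_log (N.val_pos hx'), val_smul_of_nonneg _ (inv_nonneg.2 (norm_nonneg x)),
          mul_inv_cancel_left₀ (norm_ne_zero_iff.2 hx)]

theorem continuous_expExtension (x : Pt d) :
    Continuous fun f : C(Metric.sphere (0 : Pt d) 1, ℝ) => expExtension f x := by
  unfold expExtension
  split_ifs with hx
  · exact continuous_const
  · exact continuous_const.mul (Real.continuous_exp.comp (continuous_eval_const _))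

theorem range_logOnSphere : Set.range (logOnSphere (d := d)) =
    {f | ∀ x y, expExtension f (x + y) ≤ expExtension f x + expExtension f y} ∩
      {f | ∀ (a : ℝ) x, expExtension f (a • x) = |a| * expExtension f x} := by
  ext f
  constructor
  · rintro ⟨N, rfl⟩
    simp only [Set.mem_inter_iff, Set.mem_ofPred_eq, expExtension_logOnSphere]
    exact ⟨N.val_add_le, N.val_smul⟩
  · rintro ⟨hadd, hsmul⟩
    refine ⟨⟨Seminorm.of (expExtension f) hadd hsmul, fun x hx => ?_⟩, ?_⟩
    · by_contra hx₀
      exact (expExtension_pos f hx₀).ne' hx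
    · ext x
      change Real.log (expExtension f x) = f x
      rw [expExtension_coe_sphere, Real.log_exp]

theorem isClosed_range_logOnSphere : IsClosed (Set.range (logOnSphere (d := d))) := by
  rw [range_logOnSphere]
  simp only [Set.ofPred_forall]
  exact (isClosed_iInter fun x => isClosed_iInter fun y => isClosed_le (continuous_expExtension _)
      ((continuous_expExtension _).add (continuous_expExtension _))).inter
    (isClosed_iInter fun a => isClosed_iInter fun x => isClosed_eq (continuous_expExtension _)
      (continuous_const.mul (continuous_expExtension _)))

theorem logOnSphere_injective : Function.Injective (logOnSphere (d := d)) := fun N M h =>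
  eq_of_unitBall_eq <| Set.ext fun x => by
    change N.val x ≤ 1 ↔ M.val x ≤ 1
    rw [← expExtension_logOnSphere, h, expExtension_logOnSphere]

theorem logOnSphere_le_log_add_iff (hc : 0 < c) :
    (∀ x, M.logOnSphere x ≤ Real.log c + N.logOnSphere x) ↔ ∀ x, M.val x ≤ c * N.val x := by
  have hlog : ∀ x : Metric.sphere (0 : Pt d) 1,
      M.logOnSphere x ≤ Real.log c + N.logOnSphere x ↔ M.val x ≤ c * N.val x := fun x => by
    have hx := ne_zero_of_mem_unit_sphere x
    change Real.log _ ≤ _ + Real.log _ ↔ _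
    rw [← Real.log_mul hc.ne' (N.val_pos hx).ne',
      Real.log_le_log_iff (M.val_pos hx) (mul_pos hc (N.val_pos hx))]
  refine (forall_congr' hlog).trans ⟨fun h x => ?_, fun h x => h x⟩
  by_cases hx : x = 0
  · simp only [hx, val_zero, mul_zero, le_refl]
  have hx' := inv_pos.2 (norm_pos_iff.2 hx)
  have hsphere := h ⟨‖x‖⁻¹ • x, by simp [norm_smul, hx]⟩
  rwa [val_smul_of_nonneg _ hx'.le, val_smul_of_nonneg _ hx'.le, mul_left_comm,
    mul_le_mul_iff_right₀ hx'] at hsphere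

theorem withinFactor_iff_dist_logOnSphere_le (hc : 1 ≤ c) :
    WithinFactor c N M ↔ dist M.logOnSphere N.logOnSphere ≤ Real.log c := by
  have hc₀ : 0 < c := one_pos.trans_le hc
  rw [ContinuousMap.dist_le (Real.log_nonneg hc), WithinFactor, ← logOnSphere_le_log_add_iff hc₀,
    ← logOnSphere_le_log_add_iff hc₀, ← forall_and]
  refine forall_congr' fun x => ?_
  rw [Real.dist_eq, abs_le, and_comm, neg_le_sub_iff_le_add', sub_le_iff_le_add]

theorem isClosedEmbedding_logOnSphere : IsClosedEmbedding (logOnSphere (d := d)) := by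
  refine ⟨⟨isInducing_iff_nhds.2 fun N => ?_, logOnSphere_injective⟩, isClosed_range_logOnSphere⟩
  refine N.nhds_basis_withinFactor.ext (Metric.nhds_basis_closedBall.comap _)
    (fun c hc => ⟨Real.log c, Real.log_pos hc, fun M hM => ?_⟩)
    fun ε hε => ⟨Real.exp ε, Real.one_lt_exp_iff.2 hε, fun M hM => ?_⟩
  · exact (withinFactor_iff_dist_logOnSphere_le hc.le).2 hM
  · rw [Set.mem_preimage, Metric.mem_closedBall, ← Real.log_exp ε]
    exact (withinFactor_iff_dist_logOnSphere_le (Real.one_le_exp hε.le)).1 hM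

instance instBaireSpace : BaireSpace (DNorm d) :=
  have := isClosedEmbedding_logOnSphere (d := d).IsCompletelyMetrizableSpace
  inferInstance

end Topology

end DNorm

/-! ### Polyhedral norms with small facets -/

theorem norm_sub_lt_or_norm_add_lt_of_common {E : Type*} [SeminormedAddCommGroup E]
    {u v z : E} {η : ℝ} (hu : ‖u - z‖ < η / 2 ∨ ‖u + z‖ < η / 2)
    (hv : ‖v - z‖ < η / 2 ∨ ‖v + z‖ < η / 2) : ‖u - v‖ < η ∨ ‖u + v‖ < η := by
  rcases hu with hu | hu <;> rcases hv with hv | hv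
  · left
    rw [← sub_sub_sub_cancel_right u v z]
    linarith [norm_sub_le (u - z) (v - z)]
  · right
    rw [show u + v = u - z + (v + z) by abel]
    linarith [norm_add_le (u - z) (v + z)]
  · right
    rw [show u + v = u + z + (v - z) by abel]
    linarith [norm_add_le (u + z) (v - z)]
  · left
    rw [← add_sub_add_right_eq_sub u v z]
    linarith [norm_sub_le (u + z) (v + z)]

theorem sqrt_add_sq_add_add_sq_le (a b c e : ℝ) :
    √((a + b) ^ 2 + (c + e) ^ 2) ≤ √(a ^ 2 + c ^ 2) + √(b ^ 2 + e ^ 2) := by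
  simpa [Complex.norm_eq_sqrt_sq_add_sq] using norm_add_le (⟨a, c⟩ : ℂ) ⟨b, e⟩

namespace DNorm

section HilbertSum

variable {d : ℕ} (N : DNorm d) (e : ℝ)

/-- The uniformly convex norm `√(N(x)² + e²|x|²)`, where `|x|` is the Euclidean norm. -/
noncomputable def hilbertSum : DNorm d where
  toSeminorm := Seminorm.of (fun x => √(N.val x ^ 2 + (e * ‖x‖) ^ 2))
    (fun x y => by
      refine (Real.sqrt_le_sqrt ?_).trans (sqrt_add_sq_add_add_sq_le _ _ _ _)
      rw [← mul_add, mul_pow, mul_pow]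
      have := N.val_nonneg (x + y)
      gcongr
      · exact N.val_add_le x y
      · exact norm_add_le x y)
    (fun a x => by
      rw [val_smul, norm_smul, mul_left_comm e, mul_pow, mul_pow ‖a‖, Real.norm_eq_abs, ← mul_add,
        Real.sqrt_mul (sq_nonneg _), Real.sqrt_sq (abs_nonneg a)])
  eq_zero_of_map_eq_zero' x hx := by
    by_contra h
    have := N.val_pos h
    exact (Real.sqrt_pos.2 (by positivity : 0 < N.val x ^ 2 + (e * ‖x‖) ^ 2)).ne' hx

theorem hilbertSum_sq (x : Pt d) :
    (N.hilbertSum e).val x ^ 2 = N.val x ^ 2 + (e * ‖x‖) ^ 2 :=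
  Real.sq_sqrt (by positivity)

theorem le_hilbertSum (x : Pt d) : N.val x ≤ (N.hilbertSum e).val x :=
  Real.le_sqrt_of_sq_le (le_add_of_nonneg_right (sq_nonneg _))

theorem hilbertSum_le {e : ℝ} (he : 0 ≤ e) (x : Pt d) :
    (N.hilbertSum e).val x ≤ N.val x + e * ‖x‖ := by
  have hsqrt : √(N.val x ^ 2 + (e * ‖x‖) ^ 2) ≤ √(N.val x ^ 2) + √((e * ‖x‖) ^ 2) := by
    simpa using sqrt_add_sq_add_add_sq_le (N.val x) 0 0 (e * ‖x‖)
  rwa [Real.sqrt_sq (N.val_nonneg x), Real.sqrt_sq (mul_nonneg he (norm_nonneg x))] at hsqrt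

theorem exists_hilbertSum_mem {s : Set (DNorm d)} (hs : s ∈ 𝓝 N) :
    ∃ e ≠ 0, N.hilbertSum e ∈ s := by
  obtain ⟨c, hc, hcs⟩ := N.nhds_basis_withinFactor.mem_iff.1 hs
  obtain ⟨R, hR, hNR⟩ := (euclidean d).exists_val_le N
  have he : 0 < (c - 1) / R := div_pos (sub_pos.2 hc) hR
  refine ⟨(c - 1) / R, he.ne', hcs ⟨fun x => ?_, fun x => ?_⟩⟩
  · calc (N.hilbertSum ((c - 1) / R)).val x ≤ N.val x + (c - 1) / R * ‖x‖ :=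
        N.hilbertSum_le he.le x
      _ ≤ N.val x + (c - 1) / R * (R * N.val x) := by gcongr; exact hNR x
      _ = c * N.val x := by field_simp; ring
  · exact (N.le_hilbertSum _ x).trans (le_mul_of_one_le_left (val_nonneg _ x) hc.le)

theorem hilbertSum_parallelogram (x y : Pt d) :
    (N.hilbertSum e).val (x + y) ^ 2 + (e * ‖x - y‖) ^ 2 ≤
      2 * (N.hilbertSum e).val x ^ 2 + 2 * (N.hilbertSum e).val y ^ 2 := by
  have hN : N.val (x + y) ^ 2 ≤ (N.val x + N.val y) ^ 2 :=
    pow_le_pow_left₀ (N.val_nonneg _) (N.val_add_le x y) 2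
  have hpar := congrArg (e ^ 2 * ·) (parallelogram_law_with_norm ℝ x y)
  simp only [hilbertSum_sq]
  linarith [add_sq_le (a := N.val x) (b := N.val y)]

end HilbertSum

section Polyhedral

variable {d : ℕ} {ι : Type*} [Fintype ι]

/-- The norm `max |a f x| / μ f`, for functionals `a f` with no common zero but `0`. -/
noncomputable def polyhedral (a : ι → Pt d →ₗ[ℝ] ℝ) (ha : ∀ x, (∀ f, a f x = 0) → x = 0)
    (μ : ι → ℝ) (hμ : ∀ f, 0 < μ f) : DNorm d where
  toSeminorm := (normSeminorm ℝ (ι → ℝ)).comp (LinearMap.pi fun f => (μ f)⁻¹ • a f)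
  eq_zero_of_map_eq_zero' x hx := ha x fun f => by
    have hx : ‖LinearMap.pi (fun f => (μ f)⁻¹ • a f) x‖ = 0 := hx
    simpa [(hμ f).ne'] using congrFun (norm_eq_zero.1 hx) f

variable {a : ι → Pt d →ₗ[ℝ] ℝ} {ha : ∀ x, (∀ f, a f x = 0) → x = 0} {μ : ι → ℝ}
  {hμ : ∀ f, 0 < μ f}

theorem polyhedral_le_iff {x : Pt d} {r : ℝ} (hr : 0 ≤ r) :
    (polyhedral a ha μ hμ).val x ≤ r ↔ ∀ f, |a f x| ≤ μ f * r := by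
  refine (pi_norm_le_iff_of_nonneg hr).trans (forall_congr' fun f => ?_)
  rw [← inv_mul_le_iff₀ (hμ f), ← abs_of_pos (inv_pos.2 (hμ f)), ← abs_mul]
  rfl

theorem polyhedral_lt_iff {x : Pt d} {r : ℝ} (hr : 0 < r) :
    (polyhedral a ha μ hμ).val x < r ↔ ∀ f, |a f x| < μ f * r := by
  refine (pi_norm_lt_iff hr).trans (forall_congr' fun f => ?_)
  rw [← inv_mul_lt_iff₀ (hμ f), ← abs_of_pos (inv_pos.2 (hμ f)), ← abs_mul]
  rfl

theorem le_polyhedral (x : Pt d) (f : ι) : |a f x| ≤ μ f * (polyhedral a ha μ hμ).val x :=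
  (polyhedral_le_iff (val_nonneg _ x)).1 le_rfl f

theorem exists_eq_of_polyhedral_eq_one {x : Pt d} (h : (polyhedral a ha μ hμ).val x = 1) :
    ∃ f, |a f x| = μ f := by
  by_contra! hne
  refine ((polyhedral_lt_iff one_pos).2 fun f => ?_).ne h
  rw [mul_one]
  refine lt_of_le_of_ne ?_ (hne f)
  simpa only [h, mul_one] using le_polyhedral (ha := ha) (hμ := hμ) x f

end Polyhedral

section SupportNet

variable {d : ℕ} {N : DNorm d}

theorem exists_support_functional (N : DNorm d) {z : Pt d} (hz : z ≠ 0) :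
    ∃ g : Pt d →ₗ[ℝ] ℝ, g z = N.val z ∧ ∀ x, |g x| ≤ N.val x := by
  obtain ⟨g, hg, hgN⟩ := exists_extension_of_le_sublinear
    (LinearPMap.mkSpanSingleton z (N.val z) hz) N.val
    (fun c hc x => N.val_smul_of_nonneg hc.le x) N.val_add_le (by
      rintro ⟨x, hx⟩
      obtain ⟨c, rfl⟩ := Submodule.mem_span_singleton.1 hx
      rw [LinearPMap.mkSpanSingleton'_apply, val_smul, smul_eq_mul]
      exact mul_le_mul_of_nonneg_right (le_abs_self c) (N.val_nonneg z))
  refine ⟨g, ?_, fun x => abs_le'.2 ⟨hgN x, ?_⟩⟩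
  · rw [hg ⟨z, Submodule.mem_span_singleton_self z⟩]
    exact LinearPMap.mkSpanSingleton_apply ..
  · rw [← map_neg, ← val_neg]
    exact hgN (-x)

/-- Unit vectors `z f` with supporting functionals `a f` that compute the norm `N` up to the
factor `1 - κ`. -/
structure SupportNet {ι : Type*} (N : DNorm d) (κ : ℝ) (z : ι → Pt d) (a : ι → Pt d →ₗ[ℝ] ℝ) :
    Prop where
  val_eq_one : ∀ f, N.val (z f) = 1
  apply_self : ∀ f, a f (z f) = 1
  abs_le : ∀ f x, |a f x| ≤ N.val x
  exists_le : ∀ x ≠ 0, ∃ f, (1 - κ) * N.val x ≤ |a f x|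

theorem exists_finset_dense_unitSphere (N : DNorm d) {κ : ℝ} (hκ : 0 < κ) :
    ∃ T : Finset (Pt d), (∀ z ∈ T, N.val z = 1) ∧
      ∀ x, N.val x = 1 → ∃ z ∈ T, N.val (x - z) < κ := by
  have hcompact : IsCompact {x | N.val x = 1} :=
    N.isCompact_unitBall.of_isClosed_subset (isClosed_eq N.continuous_val continuous_const)
      fun x hx => le_of_eq hx
  obtain ⟨T, hT, hcover⟩ := hcompact.elim_nhds_subcover (fun z => {x | N.val (x - z) < κ})
    fun z _ => (isOpen_lt (N.continuous_val.comp (continuous_id.sub continuous_const))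
      continuous_const).mem_nhds (show N.val (z - z) < κ by rwa [sub_self, val_zero])
  refine ⟨T, hT, fun x hx => ?_⟩
  obtain ⟨z, hz, hxz⟩ := Set.mem_iUnion₂.1 (hcover hx)
  exact ⟨z, hz, hxz⟩

theorem exists_supportNet (N : DNorm d) {κ : ℝ} (hκ : 0 < κ) :
    ∃ (ι : Type) (_ : Fintype ι) (z : ι → Pt d) (a : ι → Pt d →ₗ[ℝ] ℝ), SupportNet N κ z a := by
  obtain ⟨T, hT, hnet⟩ := N.exists_finset_dense_unitSphere hκ
  have hT₀ : ∀ z : T, (z : Pt d) ≠ 0 := fun z hz => by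
    simpa [hz, val_zero] using hT z z.2
  choose a ha haN using fun z : T => N.exists_support_functional (hT₀ z)
  have ha₁ : ∀ z : T, a z z = 1 := fun z => (ha z).trans (hT z z.2)
  refine ⟨T, inferInstance, (↑), a, fun z => hT z z.2, ha₁, haN, fun x hx => ?_⟩
  obtain ⟨z, hz, hxz⟩ := hnet _ (N.val_inv_smul_self hx)
  refine ⟨⟨z, hz⟩, ?_⟩
  have happly := (abs_le.1 (haN ⟨z, hz⟩ ((N.val x)⁻¹ • x - z))).1
  rw [map_sub, ha₁ ⟨z, hz⟩, map_smul, smul_eq_mul] at happly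
  have hle : 1 - κ ≤ (N.val x)⁻¹ * a ⟨z, hz⟩ x := by linarith
  rw [inv_mul_eq_div, le_div_iff₀ (N.val_pos hx)] at hle
  exact hle.trans (le_abs_self _)

namespace SupportNet

variable {ι : Type*} {κ : ℝ} {z : ι → Pt d} {a : ι → Pt d →ₗ[ℝ] ℝ}

theorem eq_zero (H : SupportNet N κ z a) (hκ : κ < 1) {x : Pt d} (hx : ∀ f, a f x = 0) :
    x = 0 := by
  by_contra hx₀
  obtain ⟨f, hf⟩ := H.exists_le x hx₀
  rw [hx f, abs_zero] at hf
  exact hf.not_gt (mul_pos (sub_pos.2 hκ) (N.val_pos hx₀))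

theorem withinFactor_polyhedral [Fintype ι] (H : SupportNet N κ z a) (hκ₀ : 0 < κ)
    (hκ : κ ≤ 1 / 2) {ha : ∀ x, (∀ f, a f x = 0) → x = 0} {μ : ι → ℝ} {hμ : ∀ f, 0 < μ f}
    (hμκ : ∀ f, μ f ∈ Set.Ioo 1 (1 + κ)) : WithinFactor (1 + 4 * κ) N (polyhedral a ha μ hμ) := by
  have hle : ∀ x, (polyhedral a ha μ hμ).val x ≤ N.val x := fun x =>
    (polyhedral_le_iff (N.val_nonneg x)).2 fun f =>
      (H.abs_le f x).trans (le_mul_of_one_le_left (N.val_nonneg x) (hμκ f).1.le)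
  refine ⟨fun x => (hle x).trans (le_mul_of_one_le_left (N.val_nonneg x) (by linarith)),
    fun x => ?_⟩
  by_cases hx : x = 0
  · simp only [hx, val_zero, mul_zero, le_refl]
  obtain ⟨f, hf⟩ := H.exists_le x hx
  have hM := (polyhedral a ha μ hμ).val_nonneg x
  refine le_of_mul_le_mul_left (a := 1 - κ) ?_ (by linarith)
  calc (1 - κ) * N.val x ≤ μ f * (polyhedral a ha μ hμ).val x := hf.trans (le_polyhedral x f)
    _ ≤ (1 - κ) * (1 + 4 * κ) * (polyhedral a ha μ hμ).val x :=
        mul_le_mul_of_nonneg_right (by nlinarith [(hμκ f).2]) hM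
    _ = (1 - κ) * ((1 + 4 * κ) * (polyhedral a ha μ hμ).val x) := mul_assoc _ _ _

variable {e η : ℝ} {f : ι} {u : Pt d}

theorem norm_sub_lt (H : SupportNet N κ z a)
    (hN : ∀ x y, N.val (x + y) ^ 2 + (e * ‖x - y‖) ^ 2 ≤ 2 * N.val x ^ 2 + 2 * N.val y ^ 2)
    (hκ : κ ≤ 1 / 2) (hη : 0 ≤ η) (hκη : 32 * κ < (e * η) ^ 2) (hu : N.val u ≤ 1 + 4 * κ)
    (hf : 1 ≤ a f u) : ‖u - z f‖ < η := by
  have htwo : 2 ≤ N.val (u + z f) :=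
    calc 2 ≤ a f (u + z f) := by rw [map_add, H.apply_self]; linarith
      _ ≤ N.val (u + z f) := (le_abs_self _).trans (H.abs_le f _)
  have hu₂ : N.val u ^ 2 ≤ (1 + 4 * κ) ^ 2 := pow_le_pow_left₀ (N.val_nonneg u) hu 2
  have hsq : (e * ‖u - z f‖) ^ 2 < (e * η) ^ 2 := by
    have hpar := hN u (z f)
    rw [H.val_eq_one] at hpar
    nlinarith [N.val_nonneg u]
  rw [mul_pow, mul_pow] at hsq
  exact lt_of_pow_lt_pow_left₀ 2 hη (lt_of_mul_lt_mul_left hsq (sq_nonneg e))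

theorem norm_sub_lt_or_norm_add_lt (H : SupportNet N κ z a)
    (hN : ∀ x y, N.val (x + y) ^ 2 + (e * ‖x - y‖) ^ 2 ≤ 2 * N.val x ^ 2 + 2 * N.val y ^ 2)
    (hκ : κ ≤ 1 / 2) (hη : 0 ≤ η) (hκη : 32 * κ < (e * η) ^ 2) (hu : N.val u ≤ 1 + 4 * κ)
    (hf : 1 ≤ |a f u|) : ‖u - z f‖ < η ∨ ‖u + z f‖ < η := by
  rcases le_abs.1 hf with hf | hf
  · exact .inl (H.norm_sub_lt hN hκ hη hκη hu hf)
  · right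
    rw [← norm_neg, neg_add']
    exact H.norm_sub_lt hN hκ hη hκη (by rwa [val_neg]) (by rwa [map_neg])

end SupportNet

/-- The unit sphere of `M` is covered by the pairs of opposite hyperplanes `a f = ± μ f`, and any
such pair meets it in two opposite pieces of diameter less than `η`. -/
structure FacetCover {ι : Type*} (M : DNorm d) (a : ι → Pt d →ₗ[ℝ] ℝ) (μ : ι → ℝ) (η : ℝ) :
    Prop where
  exists_eq : ∀ u, M.val u = 1 → ∃ f, |a f u| = μ f
  norm_lt : ∀ f u v, M.val u = 1 → M.val v = 1 → |a f u| = μ f → |a f v| = μ f →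
    ‖u - v‖ < η ∨ ‖u + v‖ < η

theorem exists_polyhedral_of_uniformConvex {e : ℝ} (he : e ≠ 0)
    (hN : ∀ x y, N.val (x + y) ^ 2 + (e * ‖x - y‖) ^ 2 ≤ 2 * N.val x ^ 2 + 2 * N.val y ^ 2)
    {s : Set (DNorm d)} (hs : s ∈ 𝓝 N) {η : ℝ} (hη : 0 < η) :
    ∃ (ι : Type) (_ : Fintype ι) (a : ι → Pt d →ₗ[ℝ] ℝ), ∃ κ > 0,
      ∀ μ : ι → ℝ, (∀ f, μ f ∈ Set.Ioo 1 (1 + κ)) → ∃ M ∈ s, FacetCover M a μ η := by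
  obtain ⟨c, hc, hcs⟩ := N.nhds_basis_withinFactor.mem_iff.1 hs
  have hc' : 0 < (c - 1) / 4 := by linarith
  have hsmall : 0 < (e * (η / 2)) ^ 2 / 64 := by positivity
  obtain ⟨κ, hκ, hκle⟩ : ∃ κ > 0, κ ≤ min (1 / 2) (min ((c - 1) / 4) ((e * (η / 2)) ^ 2 / 64)) :=
    ⟨_, lt_min one_half_pos (lt_min hc' hsmall), le_rfl⟩
  obtain ⟨hκ₁, hκc, hκη⟩ : κ ≤ 1 / 2 ∧ κ ≤ (c - 1) / 4 ∧ κ ≤ (e * (η / 2)) ^ 2 / 64 := by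
    simpa only [le_min_iff] using hκle
  obtain ⟨ι, _, z, a, H⟩ := N.exists_supportNet hκ
  refine ⟨ι, inferInstance, a, κ, hκ, fun μ hμ => ?_⟩
  set M := polyhedral a (fun x => H.eq_zero (by linarith)) μ fun f => one_pos.trans (hμ f).1
  have hNM : WithinFactor (1 + 4 * κ) N M := H.withinFactor_polyhedral hκ hκ₁ hμ
  have hz : ∀ f u, M.val u = 1 → |a f u| = μ f → ‖u - z f‖ < η / 2 ∨ ‖u + z f‖ < η / 2 :=
    fun f u hu hf => H.norm_sub_lt_or_norm_add_lt hN hκ₁ (half_pos hη).le (by linarith)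
      (by simpa only [hu, mul_one] using hNM.2 u) (hf ▸ (hμ f).1.le)
  refine ⟨M, hcs (hNM.mono (by linarith)), fun u => exists_eq_of_polyhedral_eq_one,
    fun f u v hu hv hfu hfv => ?_⟩
  exact norm_sub_lt_or_norm_add_lt_of_common (hz f u hu hfu) (hz f v hv hfv)

theorem exists_polyhedral_mem {s : Set (DNorm d)} (hs : s ∈ 𝓝 N) {η : ℝ} (hη : 0 < η) :
    ∃ (ι : Type) (_ : Fintype ι) (a : ι → Pt d →ₗ[ℝ] ℝ), ∃ κ > 0,
      ∀ μ : ι → ℝ, (∀ f, μ f ∈ Set.Ioo 1 (1 + κ)) → ∃ M ∈ s, FacetCover M a μ η := by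
  obtain ⟨e, he, hes⟩ := N.exists_hilbertSum_mem (eventually_mem_nhds_iff.2 hs)
  exact exists_polyhedral_of_uniformConvex he (N.hilbertSum_parallelogram e) hes hη

end SupportNet

end DNorm

/-! ### Unit vectors with few parameters -/

section PolyComb

variable {σ κ τ E : Type*} [Fintype κ] [NormedAddCommGroup E] [NormedSpace ℝ E]

/-- The family of linear combinations of the vectors `p.2` whose coefficients are the values at
`p.1` of the given polynomials. -/
noncomputable def polyComb (c : τ → κ → MvPolynomial σ ℚ) (p : (σ → ℝ) × (κ → E)) (i : τ) : E :=
  ∑ l, MvPolynomial.aeval p.1 (c i l) • p.2 l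

theorem contDiff_polyComb [Fintype σ] [Fintype τ] (c : τ → κ → MvPolynomial σ ℚ) :
    ContDiff ℝ 1 (polyComb (E := E) c) := by
  refine contDiff_pi.2 fun i => ContDiff.sum fun l _ => ContDiff.smul ?_ (by fun_prop)
  refine contDiff_iff_contDiffAt.2 fun p => AnalyticAt.contDiffAt ?_
  exact AnalyticAt.aeval_mvPolynomial (fun s => ((ContinuousLinearMap.proj (R := ℝ) s).comp
    (ContinuousLinearMap.fst ℝ (σ → ℝ) (κ → E))).analyticAt p) (c i l)

open IntermediateField algebraAdjoinAdjoin in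
theorem exists_common_denominator_aeval {ι : Type*} [Finite ι] (r : σ → ℝ)
    (x : ι → IntermediateField.adjoin ℚ (Set.range r)) :
    ∃ q : ℝ, q ≠ 0 ∧ ∀ i, ∃ p : MvPolynomial σ ℚ, MvPolynomial.aeval r p = q * x i := by
  obtain ⟨q, hq⟩ := IsLocalization.exist_integer_multiples_of_finite
    (nonZeroDivisors (Algebra.adjoin ℚ (Set.range r))) x
  refine ⟨(q : Algebra.adjoin ℚ (Set.range r)),
    fun h => nonZeroDivisors.coe_ne_zero q (Subtype.ext h), fun i => ?_⟩
  obtain ⟨y, hy⟩ := hq i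
  obtain ⟨p, hp⟩ : (y : ℝ) ∈ (MvPolynomial.aeval (R := ℚ) r).range := by
    rw [← Algebra.adjoin_range_eq_range_aeval]
    exact y.2
  exact ⟨p, hp.trans (congrArg Subtype.val hy)⟩

theorem exists_polyComb_eq [Finite τ] (r : σ → ℝ)
    (W : Submodule (IntermediateField.adjoin ℚ (Set.range r)) E)
    [Module.Finite (IntermediateField.adjoin ℚ (Set.range r)) W] (u : τ → W) :
    ∃ (c : τ → Fin (Module.finrank (IntermediateField.adjoin ℚ (Set.range r)) W) →
      MvPolynomial σ ℚ) (y : _ → E), polyComb c (r, y) = fun i => (u i : E) := by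
  let b := Module.finBasis (IntermediateField.adjoin ℚ (Set.range r)) W
  obtain ⟨q, hq, hc⟩ := exists_common_denominator_aeval r fun w : τ × Fin _ => b.repr (u w.1) w.2
  choose c hc using hc
  refine ⟨fun i l => c (i, l), fun l => q⁻¹ • (b l : E), funext fun i => ?_⟩
  calc polyComb (fun i l => c (i, l)) (r, fun l => q⁻¹ • (b l : E)) i
      = ∑ l, (b.repr (u i) l : ℝ) • (b l : E) := Finset.sum_congr rfl fun l _ => by
        rw [hc, smul_smul, mul_right_comm, mul_inv_cancel₀ hq, one_mul]
    _ = ((∑ l, b.repr (u i) l • b l : W) : E) := by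
        rw [AddSubmonoidClass.coe_finsetSum]
        rfl
    _ = u i := by rw [b.sum_repr]

end PolyComb

section Dimension

variable {E ι τ : Type*} [NormedAddCommGroup E] [NormedSpace ℝ E] [FiniteDimensional ℝ E]
  [Fintype τ]

theorem dimH_setOf_comp_embedding_eq_le [Fintype ι] (φ : τ ↪ ι) {G : E → τ → ℝ}
    (hG : ContDiff ℝ 1 G) :
    dimH {ν : ι → ℝ | ∃ p, ∀ i, ν (φ i) = G p i} ≤
      (Module.finrank ℝ E + (Fintype.card ι - Fintype.card τ) : ℕ) := by
  classical
  let H : E × ({f // f ∉ Set.range φ} → ℝ) → ι → ℝ := fun q f =>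
    if h : f ∈ Set.range φ then G q.1 h.choose else q.2 ⟨f, h⟩
  have hH : ContDiff ℝ 1 H := contDiff_pi.2 fun f => by
    by_cases h : f ∈ Set.range φ
    · simp only [H, h, dite_true]
      fun_prop
    · simp only [H, h, dite_false]
      fun_prop
  have hsub : {ν : ι → ℝ | ∃ p, ∀ i, ν (φ i) = G p i} ⊆ Set.range H := by
    rintro ν ⟨p, hp⟩
    refine ⟨(p, fun f => ν f), funext fun f => ?_⟩
    by_cases h : f ∈ Set.range φ
    · simp only [H, h, dite_true]
      rw [← hp, h.choose_spec]
    · simp only [H, h, dite_false]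
  refine (dimH_mono hsub).trans (hH.dimH_range_le.trans_eq ?_)
  rw [Module.finrank_prod, Module.finrank_fintype_fun_eq_card, Fintype.card_subtype_compl]
  rw [Set.card_range_of_injective φ.injective]

theorem dense_setOf_forall_embedding_exists_ne [Finite ι]
    (hE : Module.finrank ℝ E < Fintype.card τ)
    {G : (τ ↪ ι) → E → τ → ℝ} (hG : ∀ φ, ContDiff ℝ 1 (G φ)) :
    Dense {ν : ι → ℝ | ∀ φ p, ∃ i, ν (φ i) ≠ G φ p i} := by
  have := Fintype.ofFinite ι
  have hcompl : {ν : ι → ℝ | ∀ φ p, ∃ i, ν (φ i) ≠ G φ p i} =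
      (⋃ φ, {ν | ∃ p, ∀ i, ν (φ i) = G φ p i})ᶜ := by
    ext ν
    simp
  rw [hcompl]
  rcases isEmpty_or_nonempty (τ ↪ ι) with hφ | ⟨⟨φ⟩⟩
  · rw [Set.iUnion_of_empty, Set.compl_empty]
    exact dense_univ
  refine dense_compl_of_dimH_lt_finrank ?_
  rw [dimH_iUnion, Module.finrank_fintype_fun_eq_card]
  refine (iSup_le fun φ => dimH_setOf_comp_embedding_eq_le φ (hG φ)).trans_lt ?_
  have := Fintype.card_le_of_embedding φ
  exact_mod_cast (by lia : _ < _)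

end Dimension

section Separation

variable {E τ : Type*} [NormedAddCommGroup E]

/-- The distance of any two different members of the family `u`, and of their antipodes, is at
least `η`. -/
def SeparatedUpToSign (η : ℝ) (u : τ → E) : Prop :=
  ∀ i i', i ≠ i' → η ≤ ‖u i - u i'‖ ∧ η ≤ ‖u i + u i'‖

theorem isClosed_setOf_separatedUpToSign (η : ℝ) :
    IsClosed {u : τ → E | SeparatedUpToSign η u} := by
  simp only [SeparatedUpToSign, Set.ofPred_forall, Set.ofPred_and]
  exact isClosed_iInter fun i => isClosed_iInter fun i' => isClosed_iInter fun _ =>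
    (isClosed_le (by fun_prop) (by fun_prop)).inter (isClosed_le (by fun_prop) (by fun_prop))

theorem eventually_separatedUpToSign [Finite τ] {u : τ → E} (hu : Function.Injective u)
    (hneg : ∀ i i', u i ≠ -u i') :
    ∀ᶠ j : ℕ in atTop, SeparatedUpToSign (1 / ((j : ℝ) + 1)) u := by
  have hle : ∀ x : E, x ≠ 0 → ∀ᶠ j : ℕ in atTop, 1 / ((j : ℝ) + 1) ≤ ‖x‖ := fun x hx =>
    tendsto_one_div_add_atTop_nhds_zero_nat.eventually_le_const (norm_pos_iff.2 hx)
  refine eventually_all.2 fun i => eventually_all.2 fun i' => ?_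
  by_cases h : i = i'
  · exact .of_forall fun _ hne => absurd h hne
  · filter_upwards [hle _ (sub_ne_zero.2 (hu.ne h)),
      hle (u i + u i') fun h => hneg i i' (eq_neg_of_add_eq_zero_left h)] with j h₁ h₂ _
    exact ⟨h₁, h₂⟩

end Separation

namespace DNorm

section ManyUnitVectors

variable {d : ℕ} {σ κ τ : Type*} [Fintype σ] [Fintype κ]

/-- The norms for which the vectors `polyComb c p i` are unit vectors, pairwise separated up to
sign, for some parameter `p`. The bounds in terms of `j` make the set closed. -/
def manyUnitVectors (c : τ → κ → MvPolynomial σ ℚ) (j : ℕ) : Set (DNorm d) :=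
  {N | ∃ p : (σ → ℝ) × (κ → Pt d), ‖p‖ ≤ j ∧ (∀ i, N.val (polyComb c p i) = 1) ∧
    SeparatedUpToSign (1 / ((j : ℝ) + 1)) (polyComb c p)}

theorem isClosed_manyUnitVectors [Finite τ] (c : τ → κ → MvPolynomial σ ℚ) (j : ℕ) :
    IsClosed (manyUnitVectors (d := d) c j) := by
  have := Fintype.ofFinite τ
  let K := Metric.closedBall (0 : (σ → ℝ) × (κ → Pt d)) j
  have : CompactSpace K := isCompact_iff_compactSpace.1 (isCompact_closedBall _ _)
  have hcont : Continuous fun q : DNorm d × K => polyComb c q.2.1 :=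
    (contDiff_polyComb c).continuous.comp (continuous_subtype_val.comp continuous_snd)
  have hunit : IsClosed {q : DNorm d × K | ∀ i, q.1.val (polyComb c q.2.1 i) = 1} := by
    simp only [Set.ofPred_forall]
    exact isClosed_iInter fun i => isClosed_eq (continuous_val_uncurry.comp
      (continuous_fst.prodMk ((continuous_apply i).comp hcont))) continuous_const
  have hsep := (isClosed_setOf_separatedUpToSign (1 / ((j : ℝ) + 1))).preimage hcont
  convert isClosedMap_fst_of_compactSpace _ (hunit.inter hsep) using 1
  ext N
  constructor
  · rintro ⟨p, hp, hN⟩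
    exact ⟨(N, ⟨p, mem_closedBall_zero_iff.2 hp⟩), hN, rfl⟩
  · rintro ⟨⟨N, p⟩, hN, rfl⟩
    exact ⟨p, mem_closedBall_zero_iff.1 p.2, hN⟩

theorem isNowhereDense_manyUnitVectors [Fintype τ] (c : τ → κ → MvPolynomial σ ℚ)
    (hτ : Fintype.card σ + d * Fintype.card κ < Fintype.card τ) (j : ℕ) :
    IsNowhereDense (manyUnitVectors (d := d) c j) := by
  rw [(isClosed_manyUnitVectors c j).isNowhereDense_iff, Set.eq_empty_iff_forall_notMem]
  intro N hN
  obtain ⟨ι, _, a, δ, hδ, hM⟩ := exists_polyhedral_mem (mem_interior_iff_mem_nhds.1 hN)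
    (one_div_pos.2 j.cast_add_one_pos)
  -- A unit vector `u` on the facet `f` satisfies `|a f u| = √(ν f)`, which is smooth once squared.
  have hdense : Dense {ν : ι → ℝ | ∀ (φ : τ ↪ ι) (p : (σ → ℝ) × (κ → Pt d)),
      ∃ i, ν (φ i) ≠ a (φ i) (polyComb c p i) ^ 2} :=
    dense_setOf_forall_embedding_exists_ne (by
      simpa [Module.finrank_pi_fintype, mul_comm] using hτ) fun φ =>
      contDiff_pi.2 fun i => ((a (φ i)).toContinuousLinearMap.contDiff.comp
        (contDiff_pi.1 (contDiff_polyComb c) i)).pow 2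
  obtain ⟨ν, hν, hgeneric⟩ := hdense.inter_open_nonempty _
    (isOpen_set_pi Set.finite_univ fun _ _ => isOpen_Ioo)
    (Set.univ_pi_nonempty_iff.2 fun _ : ι => Set.nonempty_Ioo.2
      (one_lt_pow₀ (lt_add_of_pos_right 1 hδ) two_ne_zero))
  obtain ⟨M, hMN, hcover⟩ := hM (fun f => √(ν f)) fun f =>
    ⟨Real.lt_sqrt_of_sq_lt (by simpa using (hν f trivial).1),
      (Real.sqrt_lt' (by linarith)).2 (hν f trivial).2⟩
  obtain ⟨p, -, hunit, hsep⟩ := hMN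
  choose φ hφ using fun i => hcover.exists_eq _ (hunit i)
  have hinj : Function.Injective φ := fun i i' h => by
    by_contra hne
    rcases hcover.norm_lt _ _ _ (hunit i) (hunit i') (hφ i) (h ▸ hφ i') with hlt | hlt
    · exact hlt.not_ge (hsep i i' hne).1
    · exact hlt.not_ge (hsep i i' hne).2
  obtain ⟨i, hi⟩ := hgeneric ⟨φ, hinj⟩ p
  refine hi ?_
  rw [Function.Embedding.coeFn_mk, ← sq_abs, hφ,
    Real.sq_sqrt (one_pos.trans (hν (φ i) trivial).1).le]

/-- The exceptional norms: for some `m` and `k`, they have more than `d k + m` unit vectors, up to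
sign, in the span of `k` vectors over a field generated by `m` numbers, although there are only
`d k + m` parameters to choose. -/
def exceptional (d : ℕ) : Set (DNorm d) :=
  ⋃ (m : ℕ) (k : ℕ) (c : Fin (d * k + m + 1) → Fin k → MvPolynomial (Fin m) ℚ) (j : ℕ),
    manyUnitVectors c j

theorem isMeagre_exceptional (d : ℕ) : IsMeagre (exceptional d) := by
  have hcount : ∀ m, Countable (MvPolynomial (Fin m) ℚ) := fun m => by
    rw [← Cardinal.mk_le_aleph0_iff]
    exact MvPolynomial.cardinalMk_le_max.trans (by simp)
  exact isMeagre_iUnion fun m => isMeagre_iUnion fun k => isMeagre_iUnion fun c =>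
    isMeagre_iUnion fun j => (isNowhereDense_manyUnitVectors c (by simp [add_comm]) j).isMeagre

theorem card_unitVectors_le {N : DNorm d} (hN : N ∉ exceptional d) {m : ℕ} (r : Fin m → ℝ)
    (W : Submodule (IntermediateField.adjoin ℚ (Set.range r)) (Pt d))
    [Module.Finite (IntermediateField.adjoin ℚ (Set.range r)) W] (U : Finset (Pt d))
    (hUW : ∀ u ∈ U, u ∈ W) (hUN : ∀ u ∈ U, N.val u = 1) (hU : ∀ u ∈ U, -u ∉ U) :
    U.card ≤ d * Module.finrank (IntermediateField.adjoin ℚ (Set.range r)) W + m := by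
  by_contra! hlt
  obtain ⟨u, hu, huU⟩ : ∃ u : Fin (d * Module.finrank _ W + m + 1) → Pt d,
      Function.Injective u ∧ ∀ i, u i ∈ U :=
    ⟨fun i => U.equivFin.symm (Fin.castLE hlt i), Subtype.val_injective.comp
      (U.equivFin.symm.injective.comp (Fin.castLE_injective hlt)), fun i => Subtype.property _⟩
  obtain ⟨c, y, hcu⟩ := exists_polyComb_eq r W fun i => ⟨u i, hUW _ (huU i)⟩
  obtain ⟨j, hj, hsep⟩ := ((eventually_ge_atTop ⌈‖(r, y)‖⌉₊).and (eventually_separatedUpToSign hu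
    fun i i' h => hU _ (huU i') (h ▸ huU i))).exists
  refine hN (Set.mem_iUnion₂.2 ⟨m, _, Set.mem_iUnion₂.2 ⟨c, j, (r, y), Nat.ceil_le.1 hj, ?_⟩⟩)
  rw [hcu]
  exact ⟨fun i => hUN _ (huU i), hsep⟩

end ManyUnitVectors

end DNorm

/-! ### Ungar's theorem -/

section Refines

variable {ι α β : Type*} [LinearOrder α] [LinearOrder β]

/-- The order of the indices by `f` refines their order by `e`: it may break the ties of `e`, but
it does not reverse any strict inequality. -/
def Refines (f : ι → α) (e : ι → β) : Prop :=
  ∀ i j, e i < e j → f i < f j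

theorem Refines.le {f : ι → α} {e : ι → β} (hf : Refines f e) {i j : ι} (h : f i < f j) :
    e i ≤ e j :=
  le_of_not_gt fun h' => (hf j i h').not_gt h

theorem Refines.apply_eq {f : ι → α} {e : ι → β} (hf : Refines f e) {i j : ι} (h : f i = f j) :
    e i = e j :=
  le_antisymm (le_of_not_gt fun h' => (hf j i h').ne' h) (le_of_not_gt fun h' => (hf i j h').ne h)

theorem Refines.neg [AddCommGroup α] [IsOrderedAddMonoid α] {f e : ι → α} (hf : Refines f e) :
    Refines (-f) (-e) :=
  fun i j h => neg_lt_neg (hf j i (neg_lt_neg_iff.1 h))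

theorem Refines.card_filter_lt_le_add_one {f f' : ι → α} {e : ι → β} (hf : Refines f e)
    (hf' : Refines f' e) {S : Finset ι} (hS : Set.InjOn e S) (z : ι) :
    (S.filter fun b => f z < f b).card ≤ (S.filter fun b => f' z < f' b).card + 1 := by
  classical
  have hsub : (S.filter fun b => f z < f b) ⊆
      (S.filter fun b => f' z < f' b) ∪ S.filter fun b => e b = e z := by
    intro b hb
    simp only [Finset.mem_filter, Finset.mem_union] at hb ⊢
    rcases (hf.le hb.2).eq_or_lt with h | h
    · exact .inr ⟨hb.1, h.symm⟩
    · exact .inl ⟨hb.1, hf' _ _ h⟩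
  refine (Finset.card_le_card hsub).trans ((Finset.card_union_le _ _).trans ?_)
  refine Nat.add_le_add_left (Finset.card_le_one.2 fun a ha b hb => ?_) _
  rw [Finset.mem_filter] at ha hb
  exact hS ha.1 hb.1 (ha.2.trans hb.2.symm)

end Refines

section Lowest

variable {ι α β : Type*} [Fintype ι] [LinearOrder α] [LinearOrder β] {N : ℕ} {f f' : ι → α}
  {i j : ι}

/-- The initial segment formed by the `N` indices with the smallest values of `f`, provided that
`f` is injective. -/
noncomputable def lowest (N : ℕ) (f : ι → α) : Finset ι :=
  {i | Finset.card {j | f j < f i} < N}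

theorem mem_lowest : i ∈ lowest N f ↔ Finset.card {j | f j < f i} < N :=
  Finset.mem_filter_univ i

theorem mem_lowest_of_le (hj : j ∈ lowest N f) (h : f i ≤ f j) : i ∈ lowest N f := by
  rw [mem_lowest] at hj ⊢
  exact (Finset.card_le_card (Finset.monotone_filter_right _ fun _ _ hl => hl.trans_le h)).trans_lt
    hj

theorem lt_of_mem_lowest (hi : i ∈ lowest N f) (hj : j ∉ lowest N f) : f i < f j :=
  lt_of_not_ge fun h => hj (mem_lowest_of_le hi h)

theorem card_lowest (hf : Function.Injective f) (hN : N ≤ Fintype.card ι) :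
    (lowest N f).card = N := by
  let := LinearOrder.lift' f hf
  let rank : ι ≃o Fin (Fintype.card ι) := (Fintype.orderIsoFinOfCardEq ι rfl).symm
  have hrank : ∀ i, Finset.card {j | f j < f i} = rank i := fun i => by
    rw [← Fin.card_Iio (rank i), ← Finset.card_map rank.toEquiv.toEmbedding]
    congr 1
    ext a
    obtain ⟨j, rfl⟩ := rank.surjective a
    have : f j < f i ↔ j < i := Iff.rfl
    simp [this]
  calc (lowest N f).card
      = (Finset.univ.filter fun a : Fin (Fintype.card ι) => (a : ℕ) < N).card := by
        refine Finset.card_equiv rank.toEquiv fun i => ?_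
        rw [mem_lowest, hrank, Finset.mem_filter_univ]
        rfl
    _ = N := by rw [Fin.card_filter_val_lt, min_eq_right hN]

theorem disjoint_lowest_neg [AddCommGroup α] [IsOrderedAddMonoid α] (hf : Function.Injective f)
    (hN : 2 * N ≤ Fintype.card ι) : Disjoint (lowest N f) (lowest N (-f)) := by
  classical
  refine Finset.disjoint_left.2 fun i hi hi' => ?_
  rw [mem_lowest] at hi hi'
  simp only [Pi.neg_apply, neg_lt_neg_iff] at hi'
  have hcover : (Finset.univ : Finset ι) ⊆ insert i
      (Finset.univ.filter (fun j => f j < f i) ∪ Finset.univ.filter fun j => f i < f j) := by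
    intro j _
    rcases lt_trichotomy (f j) (f i) with h | h | h
    · simp [h]
    · simp [hf h]
    · simp [h]
  have := (Finset.card_le_card hcover).trans ((Finset.card_insert_le _ _).trans
    (Nat.succ_le_succ (Finset.card_union_le _ _)))
  rw [Finset.card_univ] at this
  lia

theorem Refines.eq_of_mem_lowest {e : ι → β} (hf : Refines f e) (hf' : Refines f' e)
    (hi : i ∈ lowest N f) (hi' : i ∉ lowest N f') (hj : j ∉ lowest N f) (hj' : j ∈ lowest N f') :
    e i = e j :=
  (hf.le (lt_of_mem_lowest hi hj)).antisymm (hf'.le (lt_of_mem_lowest hj' hi'))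

end Lowest

/-- Ungar's combinatorial model of a rotating line: `g k i` is the height of the point `i` above a
line of the `k`-th of the `t` directions in which two points are level. Between two consecutive
such directions no two points change their order, after `t` directions the picture is upside
down, and no two points are level more than once in the meantime. -/
structure DirectionSweep {ι α : Type*} [LinearOrder α] [AddCommGroup α] (g : ℕ → ι → α) (t : ℕ) :
    Prop where
  le_succ : ∀ k i j, g k i < g k j → g (k + 1) i ≤ g (k + 1) j
  antiperiodic : Function.Antiperiodic g t
  tie : ∀ k l i j, i ≠ j → g k i = g k j → g l i = g l j → k < l → k + t ≤ l
  exists_lt : ∀ k, ∃ i j, g k i < g k j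

/-- The heights above a line between the `k`-th and the `(k + 1)`-st direction; they put the
points into a linear order. -/
def midHeight {ι α : Type*} [Add α] (g : ℕ → ι → α) (k : ℕ) : ι → α :=
  g k + g (k + 1)

theorem midHeight_neg {ι α : Type*} [AddCommGroup α] (g : ℕ → ι → α) (k : ℕ) :
    midHeight (-g) k = -midHeight g k :=
  (neg_add (g k) (g (k + 1))).symm

/-- The number of points that enter the `N` lowest ones at the `(k + 1)`-st direction. -/
noncomputable def crossing {ι α : Type*} [LinearOrder α] [Add α] [Fintype ι] [DecidableEq ι]
    (g : ℕ → ι → α) (N k : ℕ) : ℕ :=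
  (lowest N (midHeight g (k + 1)) \ lowest N (midHeight g k)).card

theorem card_lowest_sdiff_le_sum_crossing {ι α : Type*} [LinearOrder α] [Add α] [Fintype ι]
    [DecidableEq ι] (g : ℕ → ι → α) (N k n : ℕ) :
    (lowest N (midHeight g (k + n)) \ lowest N (midHeight g k)).card ≤
      ∑ j ∈ Finset.Ico k (k + n), crossing g N j := by
  induction n with
  | zero => simp
  | succ n ih =>
    rw [← add_assoc, Finset.sum_Ico_succ_top (Nat.le_add_right k n), add_comm (Finset.sum _ _)]
    refine (Finset.card_le_card (sdiff_triangle _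
      (lowest N (midHeight g (k + n))) _)).trans ((Finset.card_union_le _ _).trans ?_)
    exact Nat.add_le_add_left ih _

namespace DirectionSweep

variable {ι α : Type*} [LinearOrder α] [AddCommGroup α] {g : ℕ → ι → α} {t : ℕ}

theorem antiperiodic_midHeight (H : DirectionSweep g t) :
    Function.Antiperiodic (midHeight g) t := fun k => by
  rw [midHeight, midHeight, add_right_comm k t 1, H.antiperiodic, H.antiperiodic, neg_add]

variable [IsOrderedAddMonoid α]

theorem two_le (H : DirectionSweep g t) : 2 ≤ t := by
  obtain ⟨i, j, hij⟩ := H.exists_lt 0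
  by_contra! ht
  interval_cases t
  · have h₀ : g 0 = -g 0 := H.antiperiodic 0
    have hi := congrFun h₀ i
    have hj := congrFun h₀ j
    rw [Pi.neg_apply, self_eq_neg] at hi hj
    exact hij.ne (hi.trans hj.symm)
  · have h₁ : g 1 = -g 0 := H.antiperiodic 0
    have := H.le_succ 0 i j hij
    rw [zero_add, h₁, Pi.neg_apply, Pi.neg_apply, neg_le_neg_iff] at this
    exact this.not_gt hij

theorem refines_left (H : DirectionSweep g t) (k : ℕ) : Refines (midHeight g k) (g k) :=
  fun i j h => add_lt_add_of_lt_of_le h (H.le_succ k i j h)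

theorem refines_right (H : DirectionSweep g t) (k : ℕ) : Refines (midHeight g k) (g (k + 1)) :=
  fun i j h => add_lt_add_of_le_of_lt (le_of_not_gt fun h' => (H.le_succ k j i h').not_gt h) h

theorem injective_midHeight (H : DirectionSweep g t) (k : ℕ) :
    Function.Injective (midHeight g k) := by
  intro i j hij
  by_contra hne
  have := H.tie k (k + 1) i j hne ((H.refines_left k).apply_eq hij)
    ((H.refines_right k).apply_eq hij) k.lt_succ_self
  have := H.two_le
  lia

theorem neg (H : DirectionSweep g t) : DirectionSweep (-g) t where
  le_succ k i j h := neg_le_neg (H.le_succ k j i (neg_lt_neg_iff.1 h))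
  antiperiodic k := congrArg Neg.neg (H.antiperiodic k)
  tie k l i j hne hk hl := H.tie k l i j hne (neg_injective hk) (neg_injective hl)
  exists_lt k := by
    obtain ⟨i, j, h⟩ := H.exists_lt k
    exact ⟨j, i, neg_lt_neg h⟩

theorem card_filter_lt_le_add_sub (H : DirectionSweep g t) {S : Finset ι} {k l : ℕ} (hkl : k ≤ l)
    (hS : ∀ e ∈ Set.Ioc k l, Set.InjOn (g e) S) (z : ι) :
    (S.filter fun b => midHeight g k z < midHeight g k b).card ≤
        (S.filter fun b => midHeight g l z < midHeight g l b).card + (l - k) ∧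
      (S.filter fun b => midHeight g l z < midHeight g l b).card ≤
        (S.filter fun b => midHeight g k z < midHeight g k b).card + (l - k) := by
  induction l, hkl using Nat.le_induction with
  | base => simp
  | succ l hkl ih =>
    have := ih fun e he => hS e ⟨he.1, he.2.trans l.le_succ⟩
    have hinj := hS (l + 1) ⟨Nat.lt_succ_of_le hkl, le_rfl⟩
    have := (H.refines_right l).card_filter_lt_le_add_one (H.refines_left (l + 1)) hinj z
    have := (H.refines_left (l + 1)).card_filter_lt_le_add_one (H.refines_right l) hinj z
    lia

theorem card_le_dist (H : DirectionSweep g t) {S : Finset ι} {a b : ℕ}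
    (hS : ∀ e ∈ Set.uIoc a b, Set.InjOn (g e) S) {z : ι}
    (ha : ∀ s ∈ S, midHeight g a z < midHeight g a s)
    (hb : ∀ s ∈ S, midHeight g b s ≤ midHeight g b z) : S.card ≤ Nat.dist a b := by
  have hca : (S.filter fun s => midHeight g a z < midHeight g a s).card = S.card := by
    rw [Finset.filter_true_of_mem ha]
  have hcb : (S.filter fun s => midHeight g b z < midHeight g b s).card = 0 := by
    rw [Finset.filter_false_of_mem fun s hs => (hb s hs).not_gt, Finset.card_empty]
  rcases le_total a b with h | h
  · rw [Set.uIoc_of_le h] at hS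
    have := (H.card_filter_lt_le_add_sub h hS z).1
    rw [Nat.dist_eq_sub_of_le h]
    lia
  · rw [Set.uIoc_of_ge h] at hS
    have := (H.card_filter_lt_le_add_sub h hS z).2
    rw [Nat.dist_eq_sub_of_le_right h]
    lia

theorem apply_eq_of_isMax (H : DirectionSweep g t) {e a m : ℕ} (hea : Refines (midHeight g a) (g e))
    {L S : Finset ι} (hSL : S ⊆ L) {v : α} (hv : ∀ i ∈ S, g e i = v)
    (hL : ∃ j, g e j = v ∧ ∀ i ∈ L, midHeight g a i < midHeight g a j) {x : ι} (hxL : x ∈ L)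
    (hx : ∀ i ∈ L, midHeight g m i ≤ midHeight g m x) (hdist : Nat.dist a m < S.card)
    (he : ∀ l ∈ Set.uIoc a m, l ≠ e ∧ Nat.dist e l < t) : g e x = v := by
  obtain ⟨j, hj, hLj⟩ := hL
  refine ((hea.le (hLj x hxL)).trans_eq hj).eq_of_not_lt fun hlt => hdist.not_ge ?_
  -- As no two points of `S` are level, `x` overtakes at most one of them per direction.
  refine H.card_le_dist (fun l hl i hi i' hi' hii' => ?_)
    (fun s hs => hea _ _ (hlt.trans_eq (hv s hs).symm)) fun s hs => hx s (hSL hs)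
  by_contra hne
  have hii : g e i = g e i' := (hv i hi).trans (hv i' hi').symm
  obtain ⟨hle, hdist⟩ := he l hl
  rw [Nat.dist] at hdist
  rcases hle.lt_or_gt with h | h
  · have := H.tie l e i i' hne hii' hii h
    lia
  · have := H.tie e l i i' hne hii hii' h
    lia

variable [Fintype ι]

section Crossing

variable [DecidableEq ι] {N : ℕ}

theorem card_lowest_sdiff_comm (H : DirectionSweep g t) (hN : N ≤ Fintype.card ι) (k l : ℕ) :
    (lowest N (midHeight g k) \ lowest N (midHeight g l)).card =
      (lowest N (midHeight g l) \ lowest N (midHeight g k)).card :=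
  Finset.card_sdiff_comm <| by
    rw [card_lowest (H.injective_midHeight k) hN, card_lowest (H.injective_midHeight l) hN]

theorem apply_eq_apply_of_isMax_of_isMin (H : DirectionSweep g t) (hN : N ≤ Fintype.card ι)
    {e a b m : ℕ} (ha : Refines (midHeight g a) (g e)) (hb : Refines (midHeight g b) (g e))
    {x y : ι} (hxL : x ∈ lowest N (midHeight g a))
    (hx : ∀ i ∈ lowest N (midHeight g a), midHeight g m i ≤ midHeight g m x)
    (hyL : y ∉ lowest N (midHeight g a))
    (hy : ∀ i ∉ lowest N (midHeight g a), midHeight g m y ≤ midHeight g m i)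
    (hdist : Nat.dist a m < (lowest N (midHeight g a) \ lowest N (midHeight g b)).card)
    (he : ∀ l ∈ Set.uIoc a m, l ≠ e ∧ Nat.dist e l < t) : g e x = g e y := by
  set L := lowest N (midHeight g a)
  set T := lowest N (midHeight g b)
  have hcard : (L \ T).card = (T \ L).card := H.card_lowest_sdiff_comm hN a b
  obtain ⟨p, hp⟩ := Finset.card_pos.1 (Nat.zero_lt_of_lt hdist)
  obtain ⟨q, hq⟩ := Finset.card_pos.1 (Nat.zero_lt_of_lt (hdist.trans_eq hcard))
  have heq : ∀ i ∈ L \ T, ∀ j ∈ T \ L, g e i = g e j := fun i hi j hj => by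
    rw [Finset.mem_sdiff] at hi hj
    exact ha.eq_of_mem_lowest hb hi.1 hi.2 hj.2 hj.1
  have hxq : g e x = g e q := H.apply_eq_of_isMax ha Finset.sdiff_subset
    (fun i hi => heq i hi q hq)
    ⟨q, rfl, fun i hi => lt_of_mem_lowest hi (Finset.mem_sdiff.1 hq).2⟩ hxL hx hdist he
  have hyp : (-g) e y = (-g) e p := by
    refine H.neg.apply_eq_of_isMax (L := Lᶜ) (S := T \ L) (x := y) (a := a) (m := m) ?_
      (fun i hi => Finset.mem_compl.2 (Finset.mem_sdiff.1 hi).2)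
      (fun i hi => congrArg Neg.neg (heq p hp i hi).symm) ⟨p, rfl, fun i hi => ?_⟩
      (Finset.mem_compl.2 hyL) (fun i hi => ?_) (hdist.trans_eq hcard) he
    · rw [midHeight_neg]
      exact ha.neg
    · rw [midHeight_neg]
      exact neg_lt_neg (lt_of_mem_lowest (Finset.mem_sdiff.1 hp).1 (Finset.mem_compl.1 hi))
    · rw [midHeight_neg]
      exact neg_le_neg (hy i (Finset.mem_compl.1 hi))
  exact hxq.trans ((heq p hp q hq).symm.trans (neg_injective hyp).symm)

theorem lowest_eq_of_crossing_eq_zero (H : DirectionSweep g t) (hN : N ≤ Fintype.card ι)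
    {k l : ℕ} (hkl : k ≤ l) (h0 : ∀ j ∈ Set.Ico k l, crossing g N j = 0) :
    lowest N (midHeight g l) = lowest N (midHeight g k) := by
  induction l, hkl using Nat.le_induction with
  | base => rfl
  | succ l hl ih =>
    rw [← ih fun j hj => h0 j ⟨hj.1, hj.2.trans l.lt_succ_self⟩]
    refine Finset.eq_of_subset_of_card_le ?_ ?_
    · exact Finset.sdiff_eq_empty_iff_subset.1 (Finset.card_eq_zero.1 (h0 l ⟨hl, l.lt_succ_self⟩))
    · rw [card_lowest (H.injective_midHeight _) hN, card_lowest (H.injective_midHeight _) hN]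

theorem exists_next_crossing (H : DirectionSweep g t) (hN0 : 0 < N)
    (hN : 2 * N ≤ Fintype.card ι) (k : ℕ) :
    ∃ l ∈ Set.Ioo k (k + t), 0 < crossing g N l := by
  by_contra! hno
  have hN' : N ≤ Fintype.card ι := by lia
  set L := lowest N (midHeight g k)
  set T := lowest N (midHeight g (k + 1))
  have hT : T = lowest N (-midHeight g k) := by
    rw [← H.antiperiodic_midHeight]
    refine (H.lowest_eq_of_crossing_eq_zero hN' (by have := H.two_le; lia) fun j hj => ?_).symm
    exact Nat.le_zero.1 (hno j hj)
  have hdisj : Disjoint L T := hT ▸ disjoint_lowest_neg (H.injective_midHeight k) hN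
  have heq : ∀ i ∈ L, ∀ j ∈ T, g (k + 1) i = g (k + 1) j := fun i hi j hj =>
    (H.refines_right k).eq_of_mem_lowest (H.refines_left (k + 1)) hi
      (Finset.disjoint_left.1 hdisj hi) (Finset.disjoint_right.1 hdisj hj) hj
  have hcard : L.card = N := card_lowest (H.injective_midHeight k) hN'
  have hcard' : T.card = N := card_lowest (H.injective_midHeight (k + 1)) hN'
  obtain ⟨p, hp⟩ := Finset.card_pos.1 (hN0.trans_eq hcard.symm)
  obtain ⟨q, hq⟩ := Finset.card_pos.1 (hN0.trans_eq hcard'.symm)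
  obtain ⟨i, j, hij⟩ := H.exists_lt (k + 1)
  rcases lt_or_ge (g (k + 1) i) (g (k + 1) p) with h | h
  · have hi : i ∈ L := mem_lowest_of_le hp (H.refines_right k i p h).le
    exact h.ne ((heq i hi q hq).trans (heq p hp q hq).symm)
  · have hqj : g (k + 1) q < g (k + 1) j := (heq p hp q hq).symm.trans_lt (h.trans_lt hij)
    have hj : j ∈ T := by
      rw [hT] at hq ⊢
      exact mem_lowest_of_le hq (neg_le_neg (H.refines_right k q j hqj).le)
    exact hqj.ne ((heq p hp q hq).symm.trans (heq p hp j hj))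

theorem crossing_add_crossing_le (H : DirectionSweep g t) (hN0 : 0 < N)
    (hN : 2 * N ≤ Fintype.card ι) {k l : ℕ} (hkl : k < l) (hlt : l < k + t)
    (hk : 0 < crossing g N k) (hl : 0 < crossing g N l)
    (h0 : ∀ j ∈ Set.Ioo k l, crossing g N j = 0) :
    crossing g N k + crossing g N l + k ≤ l := by
  by_contra! hcon
  /- Some time `m` is so close to both crossings that the highest `x` of the `N` lowest points and
  the lowest `y` of the other ones at that time are level in both directions, which is impossible
  within half a turn. -/
  have hN' : N ≤ Fintype.card ι := by lia
  obtain ⟨m, hkm, hml, hmk, hlm⟩ : ∃ m, k < m ∧ m ≤ l ∧ m - (k + 1) < crossing g N k ∧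
      l - m < crossing g N l := ⟨min l (k + crossing g N k), by lia, by lia, by lia, by lia⟩
  have hLeq : ∀ j, k + 1 ≤ j → j ≤ l →
      lowest N (midHeight g j) = lowest N (midHeight g (k + 1)) := fun j hj hjl =>
    H.lowest_eq_of_crossing_eq_zero hN' hj fun i hi =>
      h0 i ⟨Nat.lt_of_succ_le hi.1, hi.2.trans_le hjl⟩
  have hcard : (lowest N (midHeight g (k + 1))).card = N :=
    card_lowest (H.injective_midHeight _) hN'
  obtain ⟨x, hxL, hx⟩ := Finset.exists_max_image (lowest N (midHeight g (k + 1))) (midHeight g m)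
    (Finset.card_pos.1 (by lia))
  obtain ⟨y, hyL, hy⟩ := Finset.exists_min_image (lowest N (midHeight g (k + 1)))ᶜ (midHeight g m)
    (Finset.card_pos.1 (by rw [Finset.card_compl]; lia))
  simp only [Finset.mem_compl] at hyL hy
  have hxyk : g (k + 1) x = g (k + 1) y := by
    refine H.apply_eq_apply_of_isMax_of_isMin hN' (H.refines_left (k + 1)) (H.refines_right k)
      hxL hx hyL hy ?_ fun j hj => ?_
    · rw [Nat.dist_eq_sub_of_le hkm]
      exact hmk
    · rw [Set.uIoc_of_le hkm, Set.mem_Ioc] at hj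
      rw [Nat.dist]
      lia
  have hxyl : g (l + 1) x = g (l + 1) y := by
    rw [← hLeq l hkl le_rfl] at hxL hx hyL hy
    refine H.apply_eq_apply_of_isMax_of_isMin hN' (H.refines_right l) (H.refines_left (l + 1))
      hxL hx hyL hy ?_ fun j hj => ?_
    · rw [Nat.dist_eq_sub_of_le_right hml, H.card_lowest_sdiff_comm hN']
      exact hlm
    · rw [Set.uIoc_of_ge hml, Set.mem_Ioc] at hj
      rw [Nat.dist]
      lia
  have hxy : x ≠ y := fun h => hyL (h ▸ hxL)
  have := H.tie (k + 1) (l + 1) x y hxy hxyk hxyl (Nat.succ_lt_succ hkl)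
  lia

theorem crossing_add_two_mul_sum_le (H : DirectionSweep g t) (hN0 : 0 < N)
    (hN : 2 * N ≤ Fintype.card ι) {k : ℕ} (hk : 0 < crossing g N k) {l : ℕ} (hkl : k ≤ l)
    (hl : 0 < crossing g N l) :
    crossing g N l + 2 * ∑ j ∈ Finset.Ico k l, crossing g N j + k ≤ l + crossing g N k := by
  induction l using Nat.strong_induction_on with
  | _ l ih =>
    rcases hkl.eq_or_lt with rfl | hlt
    · simp [add_comm]
    obtain ⟨p, hp, hpmax⟩ := Finset.exists_max_image
      ((Finset.Ico k l).filter fun j => 0 < crossing g N j) id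
      ⟨k, Finset.mem_filter.2 ⟨Finset.left_mem_Ico.2 hlt, hk⟩⟩
    simp only [Finset.mem_filter, Finset.mem_Ico, id] at hp hpmax
    have hzero : ∀ j ∈ Set.Ioo p l, crossing g N j = 0 := fun j hj => by
      by_contra hne
      have := hpmax j ⟨⟨hp.1.1.trans hj.1.le, hj.2⟩, Nat.pos_of_ne_zero hne⟩
      exact this.not_gt hj.1
    have hlp : l < p + t := by
      obtain ⟨q, hq, hqpos⟩ := H.exists_next_crossing hN0 hN p
      by_contra! hle
      exact hqpos.ne' (hzero q ⟨hq.1, hq.2.trans_le hle⟩)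
    have hsum : ∑ j ∈ Finset.Ico k l, crossing g N j =
        ∑ j ∈ Finset.Ico k p, crossing g N j + crossing g N p := by
      rw [← Finset.sum_Ico_succ_top hp.1.1]
      refine (Finset.sum_subset (Finset.Ico_subset_Ico_right hp.1.2) fun j hj hj' => ?_).symm
      rw [Finset.mem_Ico] at hj hj'
      exact hzero j ⟨by lia, hj.2⟩
    have := ih p hp.1.2 hp.1.1 hp.2
    have := H.crossing_add_crossing_le hN0 hN hp.1.2 hlp hp.2 hl hzero
    lia

theorem le_sum_crossing (H : DirectionSweep g t) (hN : 2 * N ≤ Fintype.card ι) (k : ℕ) :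
    N ≤ ∑ j ∈ Finset.Ico k (k + t), crossing g N j := by
  have hle := card_lowest_sdiff_le_sum_crossing g N k t
  rwa [Finset.sdiff_eq_self_of_disjoint, card_lowest (H.injective_midHeight _) (by lia)] at hle
  rw [H.antiperiodic_midHeight]
  exact (disjoint_lowest_neg (H.injective_midHeight k) hN).symm

end Crossing

theorem card_le (H : DirectionSweep g t) : Fintype.card ι ≤ t + 1 := by
  classical
  obtain ⟨N, hNdef⟩ : ∃ N, N = Fintype.card ι / 2 := ⟨_, rfl⟩
  have hN : 2 * N ≤ Fintype.card ι := by lia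
  rcases Nat.eq_zero_or_pos N with h0 | hN0
  · have := H.two_le
    lia
  obtain ⟨k, -, hk⟩ : ∃ k ∈ Finset.Ico 0 (0 + t), 0 < crossing g N k :=
    Finset.sum_pos_iff.1 (hN0.trans_le (H.le_sum_crossing hN 0))
  have hper : crossing g N (k + t + t) = crossing g N k := by
    have hmid : ∀ l, midHeight g (l + t + t) = midHeight g l := fun l => by
      rw [H.antiperiodic_midHeight, H.antiperiodic_midHeight, neg_neg]
    rw [crossing, add_right_comm (k + t), add_right_comm k, hmid, hmid, crossing]
  have := H.crossing_add_two_mul_sum_le hN0 hN hk (l := k + t + t) (by lia)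
    (hk.trans_eq hper.symm)
  have := H.le_sum_crossing hN k
  have := H.le_sum_crossing hN (k + t)
  have := Finset.sum_Ico_consecutive (crossing g N) (Nat.le_add_right k t)
    (Nat.le_add_right (k + t) t)
  lia

end DirectionSweep

section SlopeSweep

variable {ι K : Type*} [Field K] {t : ℕ} [NeZero t]

/-- The heights `Y i - s r * X i` of the points `(X i, Y i)` above a line whose slope runs through
the values of `s` again and again; the signs change after every round, when the line has made half
a turn. -/
def slopeSweep (X Y : ι → K) (s : Fin t → K) (k : ℕ) (i : ι) : K :=
  (-1) ^ (k / t) * (Y i - s (Fin.ofNat t k) * X i)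

variable {X Y : ι → K} {s : Fin t → K}

theorem slopeSweep_sub {i j : ι} {q : Fin t} (hq : Y j - Y i = s q * (X j - X i)) (k : ℕ) :
    slopeSweep X Y s k j - slopeSweep X Y s k i =
      (-1) ^ (k / t) * (s q - s (Fin.ofNat t k)) * (X j - X i) := by
  rw [slopeSweep, slopeSweep]
  linear_combination (-1) ^ (k / t) * hq

theorem slopeSweep_antiperiodic : Function.Antiperiodic (slopeSweep X Y s) t := fun k => by
  ext i
  have hk : Fin.ofNat t (k + t) = Fin.ofNat t k := Fin.ext (Nat.add_mod_right k t)
  rw [Pi.neg_apply, slopeSweep, slopeSweep, hk, Nat.add_div_right k (NeZero.pos t), pow_succ]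
  ring

theorem slopeSweep_eq_iff (hs : Function.Injective s) (hX : Function.Injective X) {i j : ι}
    (hij : i ≠ j) {q : Fin t} (hq : Y j - Y i = s q * (X j - X i)) (k : ℕ) :
    slopeSweep X Y s k i = slopeSweep X Y s k j ↔ q = Fin.ofNat t k := by
  rw [eq_comm, ← sub_eq_zero, slopeSweep_sub hq, mul_eq_zero,
    or_iff_left (sub_ne_zero.2 (hX.ne hij.symm)), mul_eq_zero,
    or_iff_right (pow_ne_zero _ (neg_ne_zero.2 one_ne_zero)), sub_eq_zero, hs.eq_iff]

variable [LinearOrder K] [IsStrictOrderedRing K]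

theorem slopeSweep_coeff_mul_nonneg (hs : Monotone s) (q : Fin t) (k : ℕ) :
    0 ≤ (-1) ^ (k / t) * (s q - s (Fin.ofNat t k)) *
      ((-1) ^ ((k + 1) / t) * (s q - s (Fin.ofNat t (k + 1)))) := by
  have hsign : ((-1 : K) ^ (k / t)) * (-1) ^ (k / t) = 1 := by
    rw [← pow_add, Even.neg_one_pow ⟨_, rfl⟩]
  have hk := Nat.mod_add_div k t
  have hval : ∀ l, (Fin.ofNat t l : ℕ) = l % t := fun _ => rfl
  rcases (Nat.succ_le_of_lt (Nat.mod_lt k (NeZero.pos t))).lt_or_eq with h | h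
  · obtain ⟨hdiv, hmod⟩ := (Nat.div_mod_unique (a := k + 1) (d := k / t) (NeZero.pos t)).2
      ⟨by lia, h⟩
    rw [hdiv, mul_mul_mul_comm, hsign, one_mul]
    rcases le_or_gt q (Fin.ofNat t k) with hq | hq
    · have hq' : q ≤ Fin.ofNat t (k + 1) := by
        rw [Fin.le_def, hval] at hq ⊢
        lia
      exact mul_nonneg_of_nonpos_of_nonpos (sub_nonpos.2 (hs hq)) (sub_nonpos.2 (hs hq'))
    · have hq' : Fin.ofNat t (k + 1) ≤ q := by
        rw [Fin.lt_def, hval] at hq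
        rw [Fin.le_def, hval]
        lia
      exact mul_nonneg (sub_nonneg.2 (hs hq.le)) (sub_nonneg.2 (hs hq'))
  · obtain ⟨hdiv, hmod⟩ := (Nat.div_mod_unique (a := k + 1) (d := k / t + 1) (c := 0)
      (NeZero.pos t)).2 ⟨by rw [mul_add]; lia, NeZero.pos t⟩
    have hq : q ≤ Fin.ofNat t k := by
      rw [Fin.le_def, hval]
      lia
    have hq' : Fin.ofNat t (k + 1) ≤ q := by
      rw [Fin.le_def, hval]
      lia
    refine (mul_nonneg (sub_nonneg.2 (hs hq)) (sub_nonneg.2 (hs hq'))).trans_eq ?_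
    rw [hdiv, pow_succ]
    linear_combination (s (Fin.ofNat t k) - s q) * (s q - s (Fin.ofNat t (k + 1))) * -hsign

theorem slopeSweep_le_succ (hs : Monotone s) {i j : ι} {q : Fin t}
    (hq : Y j - Y i = s q * (X j - X i)) {k : ℕ}
    (hij : slopeSweep X Y s k i < slopeSweep X Y s k j) :
    slopeSweep X Y s (k + 1) i ≤ slopeSweep X Y s (k + 1) j := by
  rw [← sub_pos, slopeSweep_sub hq] at hij
  rw [← sub_nonneg, slopeSweep_sub hq]
  refine nonneg_of_mul_nonneg_right ?_ hij
  rw [mul_mul_mul_comm]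
  exact mul_nonneg (slopeSweep_coeff_mul_nonneg hs q k) (mul_self_nonneg _)

theorem directionSweep_slopeSweep (hs : StrictMono s) (hX : Function.Injective X)
    (hXY : ∀ i j, i ≠ j → ∃ q, Y j - Y i = s q * (X j - X i))
    (hne : ∀ q, ∃ i j, Y i - s q * X i ≠ Y j - s q * X j) :
    DirectionSweep (slopeSweep X Y s) t where
  antiperiodic := slopeSweep_antiperiodic
  le_succ k i j hij := by
    obtain ⟨q, hq⟩ := hXY i j fun h => hij.ne (h ▸ rfl)
    exact slopeSweep_le_succ hs.monotone hq hij
  tie k l i j hij hk hl hkl := by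
    obtain ⟨q, hq⟩ := hXY i j hij
    rw [slopeSweep_eq_iff hs.injective hX hij hq] at hk hl
    exact Nat.ModEq.add_le_of_lt (Fin.ext_iff.1 (hk.symm.trans hl)) hkl
  exists_lt k := by
    obtain ⟨i, j, hij⟩ := hne (Fin.ofNat t k)
    have hk : slopeSweep X Y s k i ≠ slopeSweep X Y s k j := fun h =>
      hij (mul_left_cancel₀ (pow_ne_zero _ (neg_ne_zero.2 one_ne_zero)) h)
    rcases hk.lt_or_gt with h | h
    · exact ⟨i, j, h⟩
    · exact ⟨j, i, h⟩

end SlopeSweep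

section Directions

theorem card_le_card_slopes_add_one {ι K : Type*} [Fintype ι] [Field K] [LinearOrder K]
    [IsStrictOrderedRing K] {X Y : ι → K} (T : Finset K) (hX : Function.Injective X)
    (hXY : ∀ i j, i ≠ j → ∃ σ ∈ T, Y j - Y i = σ * (X j - X i))
    (hne : ∀ σ, ∃ i j, Y i - σ * X i ≠ Y j - σ * X j) : Fintype.card ι ≤ T.card + 1 := by
  obtain ⟨i, j, hij⟩ := hne 0
  obtain ⟨σ, hσ, -⟩ := hXY i j fun h => hij (h ▸ rfl)
  have : NeZero T.card := ⟨(Finset.card_pos.2 ⟨σ, hσ⟩).ne'⟩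
  refine (directionSweep_slopeSweep (T.orderEmbOfFin rfl).strictMono hX (fun i j hij => ?_)
    fun _ => hne _).card_le
  obtain ⟨σ, hσ, h⟩ := hXY i j hij
  obtain ⟨q, rfl⟩ : σ ∈ Set.range (T.orderEmbOfFin rfl) := by
    rwa [Finset.range_orderEmbOfFin]
  exact ⟨q, h⟩

variable {K E : Type*} [Field K] [AddCommGroup E] [Module K E]

theorem exists_dual_injOn [Infinite K] (P : Finset E) : ∃ X : E →ₗ[K] K, Set.InjOn X P := by
  obtain ⟨X, hX⟩ := Module.exists_dual_forall_apply_ne_zero (K := K)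
    (fun p : {p : P × P // p.1 ≠ p.2} => (p.1.1 - p.1.2 : E))
    fun p => sub_ne_zero.2 fun h => p.2 (Subtype.ext h)
  refine ⟨X, fun x hx y hy hxy => ?_⟩
  by_contra hne
  refine hX ⟨(⟨x, hx⟩, ⟨y, hy⟩), fun h => hne (congrArg Subtype.val h)⟩ ?_
  rw [map_sub, hxy, sub_self]

theorem exists_dual_of_not_collinear {P : Set E} (hP : ¬Collinear K P) {X : E →ₗ[K] K}
    (hX : Set.InjOn X P) :
    ∃ Y : E →ₗ[K] K, ∀ σ, ∃ x ∈ P, ∃ y ∈ P, Y x - σ * X x ≠ Y y - σ * X y := by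
  obtain ⟨x, hx, y, hy, hxy⟩ : P.Nontrivial := by
    by_contra h
    rcases (Set.not_nontrivial_iff.1 h).eq_empty_or_singleton with rfl | ⟨x, rfl⟩
    exacts [hP (collinear_empty K E), hP (collinear_singleton K x)]
  have hX₀ : X y - X x ≠ 0 := sub_ne_zero.2 fun h => hxy (hX hy hx h).symm
  obtain ⟨z, hz, hzne⟩ : ∃ z ∈ P, ∀ c : K, z ≠ c • (y - x) + x := by
    by_contra! h
    exact hP ((collinear_iff_of_mem hx).2 ⟨y - x, h⟩)
  obtain ⟨Y, hY⟩ : ∃ Y : E →ₗ[K] K,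
      Y (z - x - ((X z - X x) / (X y - X x)) • (y - x)) ≠ 0 := by
    by_contra! h
    have hcomb := sub_eq_zero.1 ((Module.forall_dual_apply_eq_zero_iff K _).1 h)
    exact hzne _ (sub_eq_iff_eq_add.1 hcomb)
  refine ⟨Y, fun σ => ?_⟩
  by_contra! h
  refine hY ?_
  simp only [map_sub, map_smul, smul_eq_mul]
  have hy' := h x hx y hy
  have hz' := h x hx z hz
  field_simp
  linear_combination (X z - X x) * hy' - (X y - X x) * hz'

/-- A weak form of Ungar's theorem. -/
theorem card_le_card_directions_add_one [LinearOrder K] [IsStrictOrderedRing K] (P U : Finset E)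
    (hP : ¬Collinear K (P : Set E))
    (hU : ∀ x ∈ P, ∀ y ∈ P, x ≠ y → ∃ u ∈ U, ∃ c : K, x - y = c • u) :
    P.card ≤ U.card + 1 := by
  classical
  obtain ⟨X, hX⟩ := exists_dual_injOn (K := K) P
  obtain ⟨Y, hY⟩ := exists_dual_of_not_collinear hP hX
  have hcard := card_le_card_slopes_add_one (ι := P) (X := fun p => X p) (Y := fun p => Y p)
    (U.image fun u => Y u / X u) hX.injective (fun x y hxy => ?_) fun σ => ?_
  · rw [Fintype.card_coe] at hcard
    exact hcard.trans (Nat.succ_le_succ Finset.card_image_le)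
  · obtain ⟨u, hu, c, hc⟩ := hU y y.2 x x.2 fun h => hxy (Subtype.ext h.symm)
    refine ⟨Y u / X u, Finset.mem_image_of_mem _ hu, ?_⟩
    have hXc : X y - X x = c * X u := by rw [← map_sub, hc, map_smul, smul_eq_mul]
    have hX₀ : X y - X x ≠ 0 := sub_ne_zero.2 fun h => hxy (Subtype.ext (hX y.2 x.2 h).symm)
    rw [hXc] at hX₀ ⊢
    rw [← map_sub, hc, map_smul, smul_eq_mul, mul_left_comm,
      div_mul_cancel₀ _ (right_ne_zero_of_mul hX₀)]
  · obtain ⟨x, hx, y, hy, hxy⟩ := hY σ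
    exact ⟨⟨x, hx⟩, ⟨y, hy⟩, hxy⟩

end Directions

/-! ### Distances and directions of a finite set -/

theorem exists_subset_forall_mem_or_neg_mem {α : Type*} [InvolutiveNeg α] (V : Finset α)
    (hV : ∀ v ∈ V, -v ≠ v) :
    ∃ U ⊆ V, (∀ u ∈ U, -u ∉ U) ∧ ∀ v ∈ V, v ∈ U ∨ -v ∈ U := by
  classical
  induction V using Finset.induction_on with
  | empty => exact ⟨∅, by simp⟩
  | insert v V hv ih =>
    obtain ⟨U, hUV, hU, hVU⟩ := ih fun w hw => hV w (Finset.mem_insert_of_mem hw)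
    by_cases hvU : -v ∈ U
    · exact ⟨U, hUV.trans (Finset.subset_insert _ _), hU, by grind⟩
    · refine ⟨insert v U, Finset.insert_subset_insert v hUV, fun u hu => ?_, by grind⟩
      have := hV v (Finset.mem_insert_self v V)
      rcases Finset.mem_insert.1 hu with rfl | hu
      · simp [this, hvU]
      · simp only [Finset.mem_insert, not_or]
        refine ⟨fun h => hvU ?_, hU u hu⟩
        rwa [← h, neg_neg]

theorem eq_and_eq_of_smul_sub_eq_smul_sub {R V ι : Type*} [Ring R] [AddCommGroup V] [Module R V]
    {p : ι → V} (hp : AffineIndependent R p) {a b a' b' : ι} {α β : R} (hα : α ≠ 0)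
    (hαβ : α + β ≠ 0) (hab : a ≠ b) (h : α • (p a - p b) = β • (p a' - p b')) :
    a = a' ∧ b = b' := by
  classical
  let w : ι → R := Pi.single a α - Pi.single b α - (Pi.single a' β - Pi.single b' β)
  have hw : ∀ i ∈ ({a, b, a', b'} : Finset ι), w i = 0 := by
    refine affineIndependent_iff.1 hp _ w ?_ ?_
    · simp [w, Finset.sum_sub_distrib]
    · simp [w, Finset.sum_sub_distrib, sub_smul, Pi.single_apply, ite_smul, ← smul_sub, h]
  have ha := hw a (by simp)
  have hb := hw b (by simp)
  simp only [w, Pi.sub_apply, Pi.single_apply] at ha hb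
  constructor <;> by_contra hne <;> grind

namespace DNorm

variable {d : ℕ}

/-- The set of distances, according to `N`, between different points of `P`. -/
noncomputable def distances (N : DNorm d) (P : Finset (Pt d)) : Finset ℝ :=
  open Classical in P.offDiag.image fun q => N.val (q.1 - q.2)

/-- The set of normalized differences `(x - y) / ‖x - y‖` of different points of `P`. -/
noncomputable def unitDirections (N : DNorm d) (P : Finset (Pt d)) : Finset (Pt d) :=
  open Classical in P.offDiag.image fun q => (N.val (q.1 - q.2))⁻¹ • (q.1 - q.2)

variable {N : DNorm d} {P : Finset (Pt d)} {x y : Pt d}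

theorem mem_distances {r : ℝ} :
    r ∈ N.distances P ↔ ∃ x ∈ P, ∃ y ∈ P, x ≠ y ∧ N.val (x - y) = r := by
  simp only [distances, Finset.mem_image, Finset.mem_offDiag, Prod.exists, and_assoc,
    exists_and_left]

theorem val_sub_mem_distances (hx : x ∈ P) (hy : y ∈ P) (hxy : x ≠ y) :
    N.val (x - y) ∈ N.distances P :=
  mem_distances.2 ⟨x, hx, y, hy, hxy, rfl⟩

theorem card_distances (N : DNorm d) (P : Finset (Pt d)) :
    (N.distances P).card = N.numDistances P := by
  rw [numDistances, ← Set.ncard_coe_finset]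
  congr 1
  ext r
  exact mem_distances

theorem mem_unitDirections {u : Pt d} :
    u ∈ N.unitDirections P ↔ ∃ x ∈ P, ∃ y ∈ P, x ≠ y ∧ (N.val (x - y))⁻¹ • (x - y) = u := by
  simp only [unitDirections, Finset.mem_image, Finset.mem_offDiag, Prod.exists, and_assoc,
    exists_and_left]

theorem val_of_mem_unitDirections {u : Pt d} (hu : u ∈ N.unitDirections P) : N.val u = 1 := by
  obtain ⟨x, -, y, -, hxy, rfl⟩ := mem_unitDirections.1 hu
  exact N.val_inv_smul_self (sub_ne_zero.2 hxy)

theorem card_le_numDistances_add_one_of_collinear (N : DNorm d)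
    (hP : Collinear ℝ (P : Set (Pt d))) : P.card ≤ N.numDistances P + 1 := by
  classical
  rcases P.eq_empty_or_nonempty with rfl | hne
  · exact Nat.zero_le _
  obtain ⟨p₀, v, hPv⟩ := collinear_iff_exists_forall_eq_smul_vadd _ |>.1 hP
  choose! c hc using hPv
  obtain ⟨p, hp, hmin⟩ := Finset.exists_min_image P c hne
  simp only [vadd_eq_add] at hc
  have hsub : ∀ x ∈ P, x - p = (c x - c p) • v := fun x hx => by
    linear_combination (norm := module) hc x hx - hc p hp
  rw [← card_distances, ← Finset.card_erase_add_one hp]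
  refine Nat.succ_le_succ (Finset.card_le_card_of_injOn (fun x => N.val (x - p)) ?_ ?_)
  · intro x hx
    obtain ⟨hxp, hx⟩ := Finset.mem_erase.1 hx
    exact val_sub_mem_distances hx hp hxp
  · intro x hx y hy hxy
    obtain ⟨hxp, hx⟩ := Finset.mem_erase.1 hx
    obtain ⟨-, hy⟩ := Finset.mem_erase.1 hy
    have hv : v ≠ 0 := by
      rintro rfl
      exact hxp (sub_eq_zero.1 ((hsub x hx).trans (smul_zero _)))
    dsimp only at hxy
    rw [hsub x hx, hsub y hy, N.val_smul_of_nonneg (sub_nonneg.2 (hmin x hx)),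
      N.val_smul_of_nonneg (sub_nonneg.2 (hmin y hy))] at hxy
    rw [hc x hx, hc y hy, sub_left_injective (mul_right_cancel₀ (N.val_pos hv).ne' hxy)]

section DistanceField

variable {F : IntermediateField ℚ ℝ}

theorem mem_vectorSpan_of_mem_unitDirections (hF : ↑(N.distances P) ⊆ (F : Set ℝ)) {u : Pt d}
    (hu : u ∈ N.unitDirections P) : u ∈ vectorSpan F (P : Set (Pt d)) := by
  obtain ⟨x, hx, y, hy, hxy, rfl⟩ := mem_unitDirections.1 hu
  exact Submodule.smul_mem _ (⟨_, F.inv_mem (hF (val_sub_mem_distances hx hy hxy))⟩ : F)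
    (vsub_mem_vectorSpan F hx hy)

theorem card_offDiag_le_card_unitDirections (hF : ↑(N.distances P) ⊆ (F : Set ℝ))
    {B : Finset (Pt d)} (hBP : B ⊆ P) (hB : AffineIndependent F ((↑) : B → Pt d)) :
    B.offDiag.card ≤ (N.unitDirections P).card := by
  refine Finset.card_le_card_of_injOn (fun q => (N.val (q.1 - q.2))⁻¹ • (q.1 - q.2)) ?_ ?_
  · intro q hq
    obtain ⟨ha, hb, hab⟩ := Finset.mem_offDiag.1 hq
    exact mem_unitDirections.2 ⟨_, hBP ha, _, hBP hb, hab, rfl⟩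
  · intro q hq q' hq' h
    obtain ⟨ha, hb, hab⟩ := Finset.mem_offDiag.1 hq
    obtain ⟨ha', hb', hab'⟩ := Finset.mem_offDiag.1 hq'
    let α : F := ⟨_, F.inv_mem (hF (val_sub_mem_distances (hBP ha) (hBP hb) hab))⟩
    let β : F := ⟨_, F.inv_mem (hF (val_sub_mem_distances (hBP ha') (hBP hb') hab'))⟩
    have hα : 0 < α := inv_pos.2 (N.val_pos (sub_ne_zero.2 hab))
    have hβ : 0 < β := inv_pos.2 (N.val_pos (sub_ne_zero.2 hab'))
    obtain ⟨h₁, h₂⟩ := eq_and_eq_of_smul_sub_eq_smul_sub hB (a := ⟨_, ha⟩) (b := ⟨_, hb⟩)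
      (a' := ⟨_, ha'⟩) (b' := ⟨_, hb'⟩) hα.ne' (add_pos hα hβ).ne'
      (fun h => hab (congrArg Subtype.val h)) h
    exact Prod.ext (congrArg Subtype.val h₁) (congrArg Subtype.val h₂)

theorem finrank_mul_succ_le_card_unitDirections (hF : ↑(N.distances P) ⊆ (F : Set ℝ)) :
    Module.finrank F (vectorSpan F (P : Set (Pt d))) *
      (Module.finrank F (vectorSpan F (P : Set (Pt d))) + 1) ≤ (N.unitDirections P).card := by
  obtain ⟨B, hBP, hspan, hB⟩ := exists_affineIndependent F (Pt d) (P : Set (Pt d))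
  lift B to Finset (Pt d) using P.finite_toSet.subset hBP
  rw [← direction_affineSpan, ← hspan, direction_affineSpan]
  rcases B.eq_empty_or_nonempty with rfl | hne
  · rw [Finset.coe_empty, vectorSpan_empty, finrank_bot, zero_mul]
    exact Nat.zero_le _
  have := hne.to_subtype
  have hrank := hB.finrank_vectorSpan_add_one
  rw [Subtype.range_coe, ← Nat.card_eq_fintype_card, Nat.card_coe_set_eq,
    Set.ncard_coe_finset] at hrank
  refine le_trans (le_of_eq ?_) (card_offDiag_le_card_unitDirections hF (mod_cast hBP) hB)
  rw [Finset.offDiag_card, ← hrank, ← Nat.sub_one_mul, Nat.add_sub_cancel]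

end DistanceField

theorem exists_card_le_of_notMem_exceptional (hN : N ∉ exceptional d) (P : Finset (Pt d)) :
    ∃ k, P.card ≤ d * k + N.numDistances P + 1 ∧ k * (k + 1) ≤ 2 * (d * k + N.numDistances P) := by
  classical
  by_cases hP : Collinear ℝ (P : Set (Pt d))
  · exact ⟨0, by simpa using N.card_le_numDistances_add_one_of_collinear hP, by simp⟩
  obtain ⟨U, hUV, hU, hVU⟩ := exists_subset_forall_mem_or_neg_mem (N.unitDirections P)
    fun v hv h => by
      have hv₀ : v = 0 := by linear_combination (norm := module) (-1 / 2 : ℝ) • h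
      have := val_of_mem_unitDirections hv
      rw [hv₀, val_zero] at this
      exact zero_ne_one this
  let r := (N.distances P).orderEmbOfFin (N.card_distances P)
  let F := IntermediateField.adjoin ℚ (Set.range r)
  have hF : ↑(N.distances P) ⊆ (F : Set ℝ) := by
    rw [← Finset.range_orderEmbOfFin _ (N.card_distances P)]
    exact IntermediateField.subset_adjoin ℚ _
  have hdir : P.card ≤ U.card + 1 := by
    refine card_le_card_directions_add_one P U hP fun x hx y hy hxy => ?_
    have hself := smul_inv_smul₀ (N.val_pos (sub_ne_zero.2 hxy)).ne' (x - y)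
    rcases hVU _ (mem_unitDirections.2 ⟨x, hx, y, hy, hxy, rfl⟩) with h | h
    · exact ⟨_, h, N.val (x - y), hself.symm⟩
    · exact ⟨_, h, -N.val (x - y), by rw [smul_neg, neg_smul, neg_neg, hself]⟩
  have hhalf : (N.unitDirections P).card ≤ 2 * U.card := by
    have hsub : N.unitDirections P ⊆ U ∪ U.image Neg.neg := fun v hv =>
      Finset.mem_union.2 <| (hVU v hv).imp_right fun h =>
        Finset.mem_image.2 ⟨-v, h, neg_neg v⟩
    have := (Finset.card_le_card hsub).trans (Finset.card_union_le _ _)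
    have := Finset.card_image_le (s := U) (f := Neg.neg)
    lia
  have := finiteDimensional_vectorSpan_of_finite F P.finite_toSet
  have hUcard := card_unitVectors_le hN r (vectorSpan F (P : Set (Pt d))) U
    (fun u hu => mem_vectorSpan_of_mem_unitDirections hF (hUV hu))
    (fun u hu => val_of_mem_unitDirections (hUV hu)) hU
  have hrank := finrank_mul_succ_le_card_unitDirections hF
  exact ⟨_, hdir.trans (Nat.succ_le_succ hUcard),
    hrank.trans (hhalf.trans (Nat.mul_le_mul_left 2 hUcard))⟩

/-- The relative error `ε(n)` of the lower bound `(1 - ε(n)) n`, chosen so that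
`ε(n) n = 1 + d (2 d + √(2 n))`. -/
noncomputable def errorTerm (d n : ℕ) : ℝ := (1 + 2 * d ^ 2) / n + d * √(2 / n)

theorem tendsto_errorTerm (d : ℕ) : Tendsto (errorTerm d) atTop (𝓝 0) := by
  have hsqrt : Tendsto (fun n : ℕ => √(2 / n)) atTop (𝓝 0) := by
    simpa using (tendsto_const_div_atTop_nhds_zero_nat 2).sqrt
  have hsum := (tendsto_const_div_atTop_nhds_zero_nat (1 + 2 * (d : ℝ) ^ 2)).add
    (hsqrt.const_mul (d : ℝ))
  rwa [mul_zero, add_zero] at hsum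

theorem errorTerm_mul_self (d : ℕ) {n : ℕ} (hn : n ≠ 0) :
    errorTerm d n * n = 1 + d * (2 * d + √(2 * n)) := by
  have hn₀ : (n : ℝ) ≠ 0 := Nat.cast_ne_zero.2 hn
  have hsqrt : √(2 / n) * n = √(2 * n) := by
    rw [← Real.sqrt_sq (Nat.cast_nonneg n), ← Real.sqrt_mul (by positivity),
      Real.sqrt_sq (Nat.cast_nonneg n)]
    congr 1
    field_simp
  rw [errorTerm, add_mul, div_mul_cancel₀ _ hn₀, mul_assoc, hsqrt]
  ring

theorem le_numDistances (hN : N ∉ exceptional d) (P : Finset (Pt d)) :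
    (1 - errorTerm d P.card) * (P.card : ℝ) ≤ N.numDistances P := by
  rcases eq_or_ne P.card 0 with h₀ | h₀
  · simp [h₀]
  rw [sub_mul, one_mul, errorTerm_mul_self d h₀]
  rcases le_total (P.card : ℝ) (N.numDistances P) with hle | hle
  · exact (sub_le_self _ (by positivity)).trans hle
  obtain ⟨k, hcard, hk⟩ := exists_card_le_of_notMem_exceptional hN P
  have hcard : (P.card : ℝ) ≤ d * k + N.numDistances P + 1 := mod_cast hcard
  have hk : (k : ℝ) * (k + 1) ≤ 2 * (d * k + N.numDistances P) := mod_cast hk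
  have hk_le : (k : ℝ) ≤ 2 * d + √(2 * P.card) := by
    rcases le_total (k : ℝ) (2 * d) with h | h
    · exact h.trans (le_add_of_nonneg_right (Real.sqrt_nonneg _))
    · rw [← sub_le_iff_le_add']
      refine Real.le_sqrt_of_sq_le ?_
      have := mul_le_mul_of_nonneg_left h (by positivity : (0 : ℝ) ≤ 2 * d)
      linarith
  linarith [mul_le_mul_of_nonneg_left hk_le (Nat.cast_nonneg d)]

section MinDistances

variable [NeZero d]

theorem exists_card_eq_numDistances_le (N : DNorm d) (n : ℕ) :
    ∃ P : Finset (Pt d), P.card = n ∧ N.numDistances P ≤ n := by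
  classical
  let v : Pt d := EuclideanSpace.single 0 1
  have hv : v ≠ 0 := by simp [v]
  have hinj : Function.Injective fun i : ℕ => (i : ℝ) • v :=
    (smul_left_injective ℝ hv).comp Nat.cast_injective
  refine ⟨(Finset.range n).image fun i : ℕ => (i : ℝ) • v, ?_, ?_⟩
  · rw [Finset.card_image_of_injective _ hinj, Finset.card_range]
  rw [← card_distances]
  have hsub : N.distances ((Finset.range n).image fun i : ℕ => (i : ℝ) • v) ⊆
      (Finset.range n).image fun i : ℕ => (i : ℝ) * N.val v := by
    intro r hr
    obtain ⟨_, hx, _, hy, -, rfl⟩ := mem_distances.1 hr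
    obtain ⟨i, hi, rfl⟩ := Finset.mem_image.1 hx
    obtain ⟨j, hj, rfl⟩ := Finset.mem_image.1 hy
    rw [Finset.mem_range] at hi hj
    refine Finset.mem_image.2 ⟨((i : ℤ) - j).natAbs, Finset.mem_range.2 (by lia), ?_⟩
    rw [← sub_smul, val_smul, Nat.cast_natAbs, Int.cast_abs, Int.cast_sub, Int.cast_natCast,
      Int.cast_natCast]
  exact (Finset.card_le_card hsub).trans (Finset.card_image_le.trans_eq (Finset.card_range n))

theorem minDistances_le (N : DNorm d) (n : ℕ) : N.minDistances n ≤ n := by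
  obtain ⟨P, hP, hle⟩ := N.exists_card_eq_numDistances_le n
  have hmin : N.minDistances n ≤ N.numDistances P := Nat.sInf_le ⟨P, hP, rfl⟩
  exact hmin.trans hle

theorem exists_card_eq_numDistances_eq_minDistances (N : DNorm d) (n : ℕ) :
    ∃ P : Finset (Pt d), P.card = n ∧ N.numDistances P = N.minDistances n := by
  obtain ⟨P, hP, -⟩ := N.exists_card_eq_numDistances_le n
  exact Nat.sInf_mem (s := {k | ∃ P : Finset (Pt d), P.card = n ∧ N.numDistances P = k})
    ⟨_, P, hP, rfl⟩

theorem isEquivalent_minDistances (hN : N ∉ exceptional d) :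
    (fun n : ℕ => (N.minDistances n : ℝ)) ~[atTop] (fun n : ℕ => (n : ℝ)) := by
  rw [IsEquivalent, isLittleO_iff]
  intro c hc
  filter_upwards [(tendsto_errorTerm d).eventually_le_const hc] with n hn
  obtain ⟨P, rfl, hP⟩ := N.exists_card_eq_numDistances_eq_minDistances n
  have hlower := le_numDistances hN P
  rw [hP] at hlower
  have hupper : (N.minDistances P.card : ℝ) ≤ P.card := mod_cast N.minDistances_le P.card
  have herror := mul_le_mul_of_nonneg_right hn (Nat.cast_nonneg (α := ℝ) P.card)
  rw [Pi.sub_apply, Real.norm_of_nonpos (sub_nonpos.2 hupper),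
    Real.norm_of_nonneg (Nat.cast_nonneg _)]
  linarith

end MinDistances

theorem exists_notMem_exceptional (d : ℕ) : ∃ N : DNorm d, N ∉ exceptional d :=
  (dense_of_mem_residual (isMeagre_exceptional d)).nonempty

end DNorm

/-- For `d ≥ 2` there is an error term `ε(n) → 0`, depending only on `d`, such that all `d`-norms
outside a meagre set have at least `(1 - ε(n)) n` distinct distances on every set of `n` points,
and satisfy `D(n) = (1 - o(1)) n`. Moreover, some `d`-norm does not satisfy `D(n) = o(n)`. -/
theorem theorem1p3 (d : ℕ) (hd : 2 ≤ d) :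
    (∃ ε : ℕ → ℝ, Tendsto ε atTop (𝓝 0) ∧
      ∃ S : Set (DNorm d), IsMeagre S ∧ ∀ N : DNorm d, N ∉ S →
        (∀ (n : ℕ) (P : Finset (Pt d)), P.card = n →
          (1 - ε n) * (n : ℝ) ≤ (N.numDistances P : ℝ)) ∧
        (fun n : ℕ => (N.minDistances n : ℝ)) ~[atTop] (fun n : ℕ => (n : ℝ))) ∧
    (∃ N : DNorm d,
      ¬ (fun n : ℕ => (N.minDistances n : ℝ)) =o[atTop] (fun n : ℕ => (n : ℝ))) := by
  have : NeZero d := ⟨by omega⟩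
  refine ⟨⟨DNorm.errorTerm d, DNorm.tendsto_errorTerm d, DNorm.exceptional d,
    DNorm.isMeagre_exceptional d, fun N hN => ⟨?_, DNorm.isEquivalent_minDistances hN⟩⟩, ?_⟩
  · rintro n P rfl
    exact DNorm.le_numDistances hN P
  · obtain ⟨N, hN⟩ := DNorm.exists_notMem_exceptional d
    refine ⟨N, fun h => ?_⟩
    have hself := (DNorm.isEquivalent_minDistances hN).symm.isBigO.trans_isLittleO h
    refine isLittleO_irrefl (Eventually.frequently ?_) hself
    filter_upwards [eventually_ne_atTop 0] with n hn
    exact Nat.cast_ne_zero.2 hn
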